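/- Let $F_3$ be the complete flag manifold of flags $L=(L_1\subset L_2)$ in $\mathbb C^3$ with $\dim L_i=i$, with its topology as the homogeneous space $U(3)/T^3$. The torus $T^3=(S^1)^3$ acts on $F_3$ through its coordinatewise action on $\mathbb C^3$, the diagonal circle acts trivially, and $T^2$ denotes the quotient of $T^3$ by the diagonal circle. For a $q$-dimensional subspace $L\subset\mathbb C^3$ let $P^J(L)$, where $J\subset\{1,2,3\}$ and $|J|=q$, be its Plücker coordinates (the $q\times q$ minors of a matrix whose columns form a basis of $L$), and put $$\mu_q(L)=\frac{\sum_J |P^J(L)|^2\,\delta_J}{\sum_J |P^J(L)|^2},\qquad (\delta_J)_i=1 \text{ if } i\in J,\quad (\delta_J)_i=0 \text{ if } i\notin J .$$ The map $\mu(L_1\subset L_2)=\mu_1(L_1)+\mu_2(L_2)$ is $T^2$-invariant and induces $\widehat\mu:F_3/T^2\to\mathbb R^3$. Let $P_3$ be the hexagon that is the convex hull of the six permutations of $(0,1,2)$ in $\mathbb R^3$. Then: 1. the action of $T^2$ on $F_3$ is effective, and the image of $\widehat\mu$ is $P_3$; 2. for every $x$ in the (relative) interior of $P_3$ the fibre $\widehat\mu^{-1}(x)$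 is homeomorphic to $\mathbb CP^1$; 3. the orbit space $F_3/T^2$ is homeomorphic to the join $S^1*\mathbb CP^1$, and $S^1*\mathbb CP^1$ is homeomorphic to the sphere $S^4$. -/

import Mathlib

noncomputable section

/-! ### The complete flag manifold `F₃` -/

/-- A complete flag `L₁ ⊂ L₂` in `ℂ³`: a complex line contained in a complex plane. -/
@[ext]
structure F3 where
  line : Submodule ℂ (Fin 3 → ℂ)
  plane : Submodule ℂ (Fin 3 → ℂ)
  finrank_line : Module.finrank ℂ line = 1
  finrank_plane : Module.finrank ℂ plane = 2
  line_le_plane : line ≤ plane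

/-- The span of the first `q` columns of a `3 × 3` matrix. -/
def colSpan (A : Matrix (Fin 3) (Fin 3) ℂ) (q : ℕ) (hq : q ≤ 3) : Submodule ℂ (Fin 3 → ℂ) :=
  Submodule.span ℂ (Set.range fun a : Fin q => A.col (Fin.castLE hq a))

theorem finrank_colSpan (A : Matrix.unitaryGroup (Fin 3) ℂ) (q : ℕ) (hq : q ≤ 3) :
    Module.finrank ℂ (colSpan (A : Matrix (Fin 3) (Fin 3) ℂ) q hq) = q := by
  have hu : IsUnit (A : Matrix (Fin 3) (Fin 3) ℂ) := (Unitary.toUnits A).isUnit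
  have hli := (Matrix.linearIndependent_cols_of_isUnit hu).comp _ (Fin.castLE_injective hq)
  have h := finrank_span_eq_card hli
  rw [Fintype.card_fin] at h
  exact h

theorem colSpan_mono (A : Matrix (Fin 3) (Fin 3) ℂ) {p q : ℕ} (hp : p ≤ 3) (hq : q ≤ 3)
    (hpq : p ≤ q) : colSpan A p hp ≤ colSpan A q hq := by
  refine Submodule.span_mono ?_
  rintro _ ⟨a, rfl⟩
  exact ⟨Fin.castLE hpq a, rfl⟩

/-- The flag of a unitary matrix: the spans of its first column and of its first two columns.
Its fibres are the cosets of the diagonal torus, so it identifies `F₃` with `U(3)/T³`. -/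
def unitaryFlag (A : Matrix.unitaryGroup (Fin 3) ℂ) : F3 where
  line := colSpan A 1 (by norm_num)
  plane := colSpan A 2 (by norm_num)
  finrank_line := finrank_colSpan A 1 _
  finrank_plane := finrank_colSpan A 2 _
  line_le_plane := colSpan_mono _ _ _ (by norm_num)

/-- The topology of the homogeneous space `F₃ = U(3)/T³`, that is, the quotient topology
for the map `U(3) → F₃`. -/
instance : TopologicalSpace F3 := TopologicalSpace.coinduced unitaryFlag inferInstance

/-! ### The torus action -/

/-- The linear automorphism `(z₁, z₂, z₃) ↦ (t₁ z₁, t₂ z₂, t₃ z₃)` of `ℂ³`. -/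
def diagEquiv (t : Fin 3 → Circle) : (Fin 3 → ℂ) ≃ₗ[ℂ] (Fin 3 → ℂ) :=
  LinearEquiv.piCongrRight fun i => DistribMulAction.toLinearEquiv ℂ ℂ (t i)

theorem diagEquiv_apply (t : Fin 3 → Circle) (z : Fin 3 → ℂ) (i : Fin 3) :
    diagEquiv t z i = (t i : ℂ) * z i := rfl

/-- The canonical action of `T³` on flags, `t • (L₁ ⊂ L₂) = (t L₁ ⊂ t L₂)`. -/
instance : MulAction (Fin 3 → Circle) F3 where
  smul t L :=
    { line := L.line.map (diagEquiv t).toLinearMap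
      plane := L.plane.map (diagEquiv t).toLinearMap
      finrank_line := by rw [LinearEquiv.finrank_map_eq, L.finrank_line]
      finrank_plane := by rw [LinearEquiv.finrank_map_eq, L.finrank_plane]
      line_le_plane := Submodule.map_mono L.line_le_plane }
  one_smul L := by
    have h : (diagEquiv 1).toLinearMap = LinearMap.id := by
      ext; simp [diagEquiv]
    ext1
    · change L.line.map (diagEquiv 1).toLinearMap = _
      rw [h, Submodule.map_id]
    · change L.plane.map (diagEquiv 1).toLinearMap = _
      rw [h, Submodule.map_id]
  mul_smul s t L := by
    have h : (diagEquiv (s * t)).toLinearMap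
        = (diagEquiv s).toLinearMap ∘ₗ (diagEquiv t).toLinearMap := by
      apply LinearMap.ext
      intro z
      funext i
      simp [diagEquiv_apply, mul_assoc]
    ext1
    · change L.line.map (diagEquiv (s * t)).toLinearMap
        = (L.line.map (diagEquiv t).toLinearMap).map (diagEquiv s).toLinearMap
      rw [h, Submodule.map_comp]
    · change L.plane.map (diagEquiv (s * t)).toLinearMap
        = (L.plane.map (diagEquiv t).toLinearMap).map (diagEquiv s).toLinearMap
      rw [h, Submodule.map_comp]

theorem F3.smul_line (t : Fin 3 → Circle) (L : F3) :
    (t • L).line = L.line.map (diagEquiv t).toLinearMap := rfl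

theorem F3.smul_plane (t : Fin 3 → Circle) (L : F3) :
    (t • L).plane = L.plane.map (diagEquiv t).toLinearMap := rfl

/-- The diagonal circle `{(t, t, t)}` in `T³`. -/
def diagonalCircle : Subgroup (Fin 3 → Circle) where
  carrier := {t | ∀ i j, t i = t j}
  one_mem' _ _ := rfl
  mul_mem' hs ht i j := by simp only [Pi.mul_apply, hs i j, ht i j]
  inv_mem' hs i j := by simp only [Pi.inv_apply, hs i j]

/-- The torus `T² = T³ / {(t, t, t)}`. -/
abbrev Torus2 : Type := (Fin 3 → Circle) ⧸ diagonalCircle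

theorem map_diagEquiv_of_mem {t : Fin 3 → Circle} (ht : t ∈ diagonalCircle)
    (W : Submodule ℂ (Fin 3 → ℂ)) : W.map (diagEquiv t).toLinearMap = W := by
  have hs : ∀ z : Fin 3 → ℂ, diagEquiv t z = (t 0 : ℂ) • z := by
    intro z
    funext i
    rw [diagEquiv_apply, ht i 0]
    rfl
  ext z
  simp only [Submodule.mem_map, LinearEquiv.coe_coe]
  constructor
  · rintro ⟨w, hw, rfl⟩
    rw [hs]
    exact W.smul_mem _ hw
  · intro hz
    refine ⟨(t 0 : ℂ)⁻¹ • z, W.smul_mem _ hz, ?_⟩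
    rw [hs, smul_inv_smul₀ (Circle.coe_ne_zero _)]

theorem diagonalCircle_le_ker : diagonalCircle ≤ (MulAction.toPermHom (Fin 3 → Circle) F3).ker := by
  intro t ht
  rw [MonoidHom.mem_ker]
  ext1 L
  change t • L = L
  ext1
  · exact map_diagEquiv_of_mem ht _
  · exact map_diagEquiv_of_mem ht _

/-- The action of `T²` on `F₃` induced by the canonical action of `T³`. -/
instance : MulAction Torus2 F3 :=
  MulAction.compHom F3
    (QuotientGroup.lift diagonalCircle (MulAction.toPermHom (Fin 3 → Circle) F3)
      diagonalCircle_le_ker)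

theorem Torus2.mk_smul (t : Fin 3 → Circle) (L : F3) : (t : Torus2) • L = t • L := rfl

/-- The orbit space `F₃/T²`, with the quotient topology. -/
abbrev OrbitSpace : Type := MulAction.orbitRel.Quotient Torus2 F3

/-! ### The moment map -/

/-- The Plücker coordinate `P^J` of the matrix with columns `v`: the determinant of the square
submatrix on the rows in `J`, in increasing order. -/
def plucker {n q : ℕ} (v : Fin q → Fin n → ℂ) (J : {J : Finset (Fin n) // J.card = q}) : ℂ :=
  (Matrix.of fun a b => v b (J.1.orderEmbOfFin J.2 a)).det

/-- The vertex `δ_J` of the hypersimplex. -/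
def delta {n : ℕ} (J : Finset (Fin n)) : Fin n → ℝ := fun i => if i ∈ J then 1 else 0

/-- The expression `∑ |P^J|² δ_J / ∑ |P^J|²` for a matrix with columns `v`. -/
def frameMoment {n q : ℕ} (v : Fin q → Fin n → ℂ) : Fin n → ℝ :=
  (∑ J, ‖plucker v J‖ ^ 2)⁻¹ • ∑ J, ‖plucker v J‖ ^ 2 • delta J.1

/-- The moment map of the Grassmannian of `q`-dimensional subspaces of `ℂⁿ`, computed in a basis
of the subspace; by `grassmannMoment_eq` the choice of the basis does not matter. -/
def grassmannMoment {n q : ℕ} (L : Submodule ℂ (Fin n → ℂ)) (hL : Module.finrank ℂ L = q) :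
    Fin n → ℝ :=
  frameMoment fun a => (Module.finBasisOfFinrankEq ℂ L hL a : Fin n → ℂ)

theorem grassmannMoment_eq {n q : ℕ} (L : Submodule ℂ (Fin n → ℂ)) (hL : Module.finrank ℂ L = q)
    (b : Module.Basis (Fin q) ℂ L) :
    grassmannMoment L hL = frameMoment fun a => (b a : Fin n → ℂ) := by
  set e := Module.finBasisOfFinrankEq ℂ L hL with he
  have hmul : ∀ J : {J : Finset (Fin n) // J.card = q},
      plucker (fun a => (b a : Fin n → ℂ)) J
        = plucker (fun a => (e a : Fin n → ℂ)) J * (e.toMatrix b).det := by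
    intro J
    unfold plucker
    rw [← Matrix.det_mul]
    congr 1
    ext i a
    have h : ((∑ k, e.toMatrix b k a • e k : L) : Fin n → ℂ) = b a := by
      rw [e.sum_toMatrix_smul_self b a]
    rw [Matrix.mul_apply]
    change (b a : Fin n → ℂ) _ = _
    rw [← h, Submodule.coe_sum, Finset.sum_apply]
    exact Finset.sum_congr rfl fun k _ => mul_comm _ _
  have hdet : (e.toMatrix b).det ≠ 0 := by
    intro h0
    have h1 := congrArg Matrix.det (e.toMatrix_mul_toMatrix_flip b)
    rw [Matrix.det_mul, h0, zero_mul, Matrix.det_one] at h1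
    exact zero_ne_one h1
  have hc : ‖(e.toMatrix b).det‖ ^ 2 ≠ 0 := pow_ne_zero _ (norm_ne_zero_iff.2 hdet)
  change frameMoment (fun a => (e a : Fin n → ℂ)) = _
  unfold frameMoment
  simp only [hmul, norm_mul, mul_pow]
  rw [← Finset.sum_mul]
  simp only [mul_comm _ (‖(e.toMatrix b).det‖ ^ 2), mul_smul]
  rw [← Finset.smul_sum, smul_smul, mul_inv, mul_right_comm, inv_mul_cancel₀ hc, one_mul]

/-- The moment map of `F₃`, `μ(L₁ ⊂ L₂) = μ₁(L₁) + μ₂(L₂)`. -/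
def flagMoment (L : F3) : Fin 3 → ℝ :=
  grassmannMoment L.line L.finrank_line + grassmannMoment L.plane L.finrank_plane

theorem plucker_smul {n q : ℕ} (c : Fin n → ℂ) (v : Fin q → Fin n → ℂ)
    (J : {J : Finset (Fin n) // J.card = q}) :
    plucker (fun a i => c i * v a i) J = (∏ a, c (J.1.orderEmbOfFin J.2 a)) * plucker v J := by
  unfold plucker
  rw [← Matrix.det_mul_column]
  rfl

theorem grassmannMoment_map {q : ℕ} (t : Fin 3 → Circle) (L : Submodule ℂ (Fin 3 → ℂ))
    (hL : Module.finrank ℂ L = q)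
    (hL' : Module.finrank ℂ (L.map (diagEquiv t).toLinearMap) = q) :
    grassmannMoment (L.map (diagEquiv t).toLinearMap) hL' = grassmannMoment L hL := by
  rw [grassmannMoment_eq _ _
    ((Module.finBasisOfFinrankEq ℂ L hL).map ((diagEquiv t).submoduleMap L))]
  have h : ∀ J : {J : Finset (Fin 3) // J.card = q},
      ‖plucker (fun a => (((Module.finBasisOfFinrankEq ℂ L hL).map
        ((diagEquiv t).submoduleMap L)) a : Fin 3 → ℂ)) J‖
      = ‖plucker (fun a => (Module.finBasisOfFinrankEq ℂ L hL a : Fin 3 → ℂ)) J‖ := by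
    intro J
    have h1 := plucker_smul (fun i => (t i : ℂ))
      (fun a => (Module.finBasisOfFinrankEq ℂ L hL a : Fin 3 → ℂ)) J
    change ‖plucker (fun a i => (t i : ℂ) * (Module.finBasisOfFinrankEq ℂ L hL a : Fin 3 → ℂ) i) J‖
      = _
    rw [h1, norm_mul, norm_prod, Finset.prod_eq_one fun a _ => Circle.norm_coe _, one_mul]
  unfold grassmannMoment frameMoment
  simp only [h]

theorem flagMoment_smul (t : Torus2) (L : F3) : flagMoment (t • L) = flagMoment L := by
  induction t using QuotientGroup.induction_on with
  | H t =>
    rw [Torus2.mk_smul]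
    exact congrArg₂ (· + ·) (grassmannMoment_map t L.line L.finrank_line _)
      (grassmannMoment_map t L.plane L.finrank_plane _)

/-- The map `F₃/T² → ℝ³` induced by the moment map. -/
def orbitMoment : OrbitSpace → Fin 3 → ℝ :=
  Quotient.lift flagMoment <| by
    rintro L L' ⟨t, rfl⟩
    exact flagMoment_smul t L'

/-- The standard permutahedron `P₃`: the convex hull of the permutations of `(0, 1, 2)`.
It is a hexagon in the plane `x + y + z = 3`. -/
def hexagon : Set (Fin 3 → ℝ) :=
  convexHull ℝ (Set.range fun (σ : Equiv.Perm (Fin 3)) (i : Fin 3) => ((σ i : ℕ) : ℝ))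

/-! ### The complex projective line and joins -/

/-- The complex projective line: the complex lines in `ℂ²`. -/
abbrev CP1 : Type := Projectivization ℂ (ℂ × ℂ)

/-- The quotient topology for the projection from the nonzero vectors of `ℂ²`. -/
instance : TopologicalSpace CP1 :=
  TopologicalSpace.coinduced
    (fun v : {v : ℂ × ℂ // v ≠ 0} => Projectivization.mk ℂ v.1 v.2) inferInstance

/-- The relation on `X × Y × [0, 1]` that collapses `Y` at the end `0` and `X` at the end `1`. -/
def joinSetoid (X Y : Type*) : Setoid (X × Y × unitInterval) where
  r p q := p = q ∨ (p.2.2 = 0 ∧ q.2.2 = 0 ∧ p.1 = q.1) ∨ (p.2.2 = 1 ∧ q.2.2 = 1 ∧ p.2.1 = q.2.1)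
  iseqv :=
    { refl := fun _ => Or.inl rfl
      symm := by
        rintro p q (h | ⟨h, h', e⟩ | ⟨h, h', e⟩)
        · exact Or.inl h.symm
        · exact Or.inr (Or.inl ⟨h', h, e.symm⟩)
        · exact Or.inr (Or.inr ⟨h', h, e.symm⟩)
      trans := by
        rintro p q r (rfl | ⟨h, h', e⟩ | ⟨h, h', e⟩) (rfl | ⟨k, k', f⟩ | ⟨k, k', f⟩)
        · exact Or.inl rfl
        · exact Or.inr (Or.inl ⟨k, k', f⟩)
        · exact Or.inr (Or.inr ⟨k, k', f⟩)
        · exact Or.inr (Or.inl ⟨h, h', e⟩)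
        · exact Or.inr (Or.inl ⟨h, k', e.trans f⟩)
        · exact absurd (h'.symm.trans k) zero_ne_one
        · exact Or.inr (Or.inr ⟨h, h', e⟩)
        · exact absurd (k.symm.trans h') zero_ne_one
        · exact Or.inr (Or.inr ⟨h, k', e.trans f⟩) }

/-- The topological join `X * Y` of two nonempty spaces, with the quotient topology. -/
abbrev TopJoin (X Y : Type*) : Type _ := Quotient (joinSetoid X Y)

end

/-!
A flag `L₁ ⊂ L₂` is the pair of a unit vector `z` spanning `L₁` and a unit vector `n` orthogonal to
`L₂`, each up to a phase, with `z ⟂ n`: the first and the last column of a unitary matrix. The torus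
`T³` multiplies each pair `(zᵢ, nᵢ)` by a phase, so it is divided out by applying the Hopf map
`hopf (u, v) = (2 u v̄, |u|² - |v|²)` to each pair. This gives three vectors `yᵢ = (wᵢ, xᵢ)` of
`ℂ × ℝ`. Orthogonality of `z` and `n` and equality of their lengths say that `∑ yᵢ = 0`, and the
normalisation of the lengths says that `∑ ‖yᵢ‖ = 2`. The phases of `z` and `n` which are left rotate
all `wᵢ` by a common phase. So `F₃/T²` is the space of triangles of perimeter `2` in `ℂ × ℝ`, up to
rotations about the axis `ℝ` (`exists_side_eq`, `orbitProj_eq_iff_side`).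

Such a triangle is a point of the unit sphere, for the norm "perimeter", of the space `ℂ² ⊕ ℝ²` of
pairs `(w, x)`, and the circle acts on the summand `ℂ²` only. A second use of the Hopf map, now on
`ℂ²`, divides out this circle and shows that `F₃/T²` is a sphere in `(ℂ × ℝ) ⊕ ℝ²` up to radial
projection (`orbitInvariant`, `orbitHomeo`). The unit sphere of this direct sum is the join of the
unit spheres of the summands, which are `ℂP¹ = S²` and `S¹` (`cp1Homeo`, `joinHomeo`).

In these coordinates the moment map is `1 + x` (`flagMoment_unitaryFlag`), and the hexagon is the
set of all `1 + x` such that the degenerate triangle `(0, x)` has perimeter at most `2`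
(`mem_hexagon_iff_exists`). Over an interior point `1 + x` this perimeter is less than `2`, so the
vectors `w` for which `(w, x)` has perimeter `2` form a star-shaped sphere in `ℂ²`; its quotient by
the circle is the fibre, and by the Hopf map it is `S² = ℂP¹` (`nonempty_fibre_homeo`).

All homeomorphisms are obtained as continuous bijections from compact to Hausdorff spaces.
-/

open Topology ComplexConjugate

/-! ### The Hopf map -/

/-- The Hopf map `ℂ² → ℂ × ℝ`, `(u, v) ↦ (2 u v̄, |u|² - |v|²)`, for the Euclidean norm of `ℂ × ℝ`:
it is onto, its fibres are the orbits of the circle acting on `ℂ²` by scalars, and it squares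
norms. -/
noncomputable def hopf (u v : ℂ) : WithLp 2 (ℂ × ℝ) :=
  WithLp.toLp 2 (2 * u * conj v, ‖u‖ ^ 2 - ‖v‖ ^ 2)

theorem hopf_fst (u v : ℂ) : (hopf u v).fst = 2 * u * conj v := rfl

theorem hopf_snd (u v : ℂ) : (hopf u v).snd = ‖u‖ ^ 2 - ‖v‖ ^ 2 := rfl

theorem continuous_hopf : Continuous fun p : ℂ × ℂ => hopf p.1 p.2 := by
  unfold hopf
  exact (WithLp.prod_continuous_toLp 2 ℂ ℝ).comp (by fun_prop)

theorem norm_hopf (u v : ℂ) : ‖hopf u v‖ = ‖u‖ ^ 2 + ‖v‖ ^ 2 := by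
  rw [← sq_eq_sq₀ (norm_nonneg _) (by positivity), WithLp.prod_norm_sq_eq_of_L2, hopf_fst, hopf_snd,
    Real.norm_eq_abs, sq_abs, norm_mul, norm_mul, RCLike.norm_conj, Complex.norm_two]
  ring

theorem hopf_mul (c u v : ℂ) : hopf (c * u) (c * v) = ‖c‖ ^ 2 • hopf u v := by
  apply WithLp.ofLp_injective
  ext1
  · change 2 * (c * u) * conj (c * v) = ‖c‖ ^ 2 • (2 * u * conj v)
    rw [Complex.real_smul, map_mul]
    push_cast
    rw [← Complex.mul_conj']
    ring
  · change ‖c * u‖ ^ 2 - ‖c * v‖ ^ 2 = ‖c‖ ^ 2 * (‖u‖ ^ 2 - ‖v‖ ^ 2)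
    rw [norm_mul, norm_mul]
    ring

theorem hopf_eq_zero_iff {u v : ℂ} : hopf u v = 0 ↔ u = 0 ∧ v = 0 := by
  rw [← norm_eq_zero, norm_hopf]
  constructor
  · intro h
    have h1 : ‖u‖ ^ 2 = 0 := by nlinarith [sq_nonneg ‖u‖, sq_nonneg ‖v‖]
    have h2 : ‖v‖ ^ 2 = 0 := by nlinarith [sq_nonneg ‖u‖, sq_nonneg ‖v‖]
    simpa using And.intro h1 h2
  · rintro ⟨rfl, rfl⟩
    simp

theorem exists_circle_mul_eq {u u' : ℂ} (h : ‖u'‖ = ‖u‖) : ∃ c : Circle, u' = c * u := by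
  by_cases hu : u = 0
  · subst hu
    exact ⟨1, by simpa using h⟩
  · refine ⟨⟨u' / u, ?_⟩, ?_⟩
    · simp [Submonoid.unitSphere, h, hu]
    · change u' = u' / u * u
      field_simp

theorem hopf_eq_iff {u v u' v' : ℂ} :
    hopf u' v' = hopf u v ↔ ∃ c : Circle, u' = c * u ∧ v' = c * v := by
  constructor
  · intro h
    have h1 := congrArg WithLp.fst h
    have h2 := congrArg WithLp.snd h
    have h3 := congrArg norm h
    rw [hopf_fst, hopf_fst] at h1
    rw [hopf_snd, hopf_snd] at h2
    rw [norm_hopf, norm_hopf] at h3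
    have hu : ‖u'‖ = ‖u‖ := by
      rw [← sq_eq_sq₀ (norm_nonneg _) (norm_nonneg _)]
      linarith
    have hv : ‖v'‖ = ‖v‖ := by
      rw [← sq_eq_sq₀ (norm_nonneg _) (norm_nonneg _)]
      linarith
    by_cases hv0 : v = 0
    · obtain ⟨c, hc⟩ := exists_circle_mul_eq hu
      refine ⟨c, hc, ?_⟩
      rw [hv0, norm_zero, norm_eq_zero] at hv
      rw [hv0, hv, mul_zero]
    · obtain ⟨c, hc⟩ := exists_circle_mul_eq hv
      refine ⟨c, ?_, hc⟩
      have hc1 : (c : ℂ) * conj (c : ℂ) = 1 := by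
        rw [Complex.mul_conj', Circle.norm_coe]; norm_num
      have hv1 : conj v ≠ 0 := (map_ne_zero _).2 hv0
      rw [hc, map_mul] at h1
      apply mul_right_cancel₀ hv1
      linear_combination (c : ℂ) / 2 * h1 - u' * conj v * hc1
  · rintro ⟨c, rfl, rfl⟩
    rw [hopf_mul, Circle.norm_coe, one_pow, one_smul]

theorem exists_hopf_eq (y : WithLp 2 (ℂ × ℝ)) : ∃ u v : ℂ, hopf u v = y := by
  have hn := WithLp.prod_norm_sq_eq_of_L2 y
  set n := ‖y‖ with hn0
  have hpos : 0 ≤ n := norm_nonneg y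
  set a := y.fst with ha
  set r := y.snd with hr
  rw [Real.norm_eq_abs, sq_abs] at hn
  have hle : r ≤ n := by nlinarith [sq_nonneg ‖a‖, abs_le_of_sq_le_sq' (show r ^ 2 ≤ n ^ 2 by
    nlinarith [sq_nonneg ‖a‖]) hpos]
  have key : ∀ u v : ℂ, 2 * u * conj v = a → ‖u‖ ^ 2 - ‖v‖ ^ 2 = r → hopf u v = y := by
    intro u v h1 h2
    apply WithLp.ofLp_injective
    exact Prod.ext h1 h2
  rcases hle.eq_or_lt with h | h
  · have ha0 : a = 0 := by
      have : ‖a‖ ^ 2 = 0 := by rw [h] at hn; linarith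
      simpa using this
    refine ⟨(√r : ℝ), 0, key _ _ (by simp [ha0]) ?_⟩
    rw [Complex.norm_real, Real.norm_eq_abs, sq_abs, Real.sq_sqrt (h ▸ hpos)]
    simp
  · set s := √((n - r) / 2) with hs
    have hs2 : s ^ 2 = (n - r) / 2 := Real.sq_sqrt (by linarith)
    have hs0 : 0 < s := Real.sqrt_pos.2 (by linarith)
    have hsc : (s : ℂ) ≠ 0 := by exact_mod_cast hs0.ne'
    refine ⟨a / (2 * s), s, key _ _ ?_ ?_⟩
    · rw [Complex.conj_ofReal]
      field_simp
    · rw [norm_div, norm_mul, Complex.norm_real, Complex.norm_two, Real.norm_eq_abs, abs_of_pos hs0]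
      rw [div_pow, mul_pow, hs2]
      have : n - r ≠ 0 := by linarith
      field_simp
      nlinarith

/-! ### The complex projective line is a sphere -/

/-- The map `ℂP¹ → S²` induced by the Hopf map. -/
noncomputable def cp1ToSphere : CP1 → Metric.sphere (0 : WithLp 2 (ℂ × ℝ)) 1 :=
  Projectivization.lift
    (fun v => ⟨‖hopf v.1.1 v.1.2‖⁻¹ • hopf v.1.1 v.1.2, by
      have h : hopf v.1.1 v.1.2 ≠ 0 := fun h => v.2 (Prod.ext_iff.2 (hopf_eq_zero_iff.1 h))
      simpa using norm_smul_inv_norm (𝕜 := ℝ) h⟩)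
    (by
      rintro ⟨v, hv⟩ ⟨w, hw⟩ t rfl
      have ht : t ≠ 0 := by
        rintro rfl
        exact hv (zero_smul _ _)
      have ht' : ‖t‖ ^ 2 ≠ 0 := pow_ne_zero _ (norm_ne_zero_iff.2 ht)
      apply Subtype.ext
      change ‖hopf (t * w.1) (t * w.2)‖⁻¹ • hopf (t * w.1) (t * w.2) =
        ‖hopf w.1 w.2‖⁻¹ • hopf w.1 w.2
      rw [hopf_mul, norm_smul, smul_smul, norm_pow, norm_norm, mul_inv, mul_right_comm,
        inv_mul_cancel₀ ht', one_mul])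

theorem cp1ToSphere_mk (v : ℂ × ℂ) (hv : v ≠ 0) :
    (cp1ToSphere (Projectivization.mk ℂ v hv) : WithLp 2 (ℂ × ℝ)) =
      ‖hopf v.1 v.2‖⁻¹ • hopf v.1 v.2 := rfl

theorem continuous_cp1ToSphere : Continuous cp1ToSphere := by
  rw [continuous_coinduced_dom]
  refine Continuous.subtype_mk (f := fun v : {v : ℂ × ℂ // v ≠ 0} =>
    ‖hopf v.1.1 v.1.2‖⁻¹ • hopf v.1.1 v.1.2) ?_ _
  have h : Continuous fun v : {v : ℂ × ℂ // v ≠ 0} => hopf v.1.1 v.1.2 :=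
    continuous_hopf.comp continuous_subtype_val
  refine (h.norm.inv₀ fun v hv => ?_).smul h
  exact v.2 (Prod.ext_iff.2 (hopf_eq_zero_iff.1 (norm_eq_zero.1 hv)))

theorem cp1ToSphere_injective : Function.Injective cp1ToSphere := by
  intro p q
  induction p using Projectivization.ind with | _ v hv
  induction q using Projectivization.ind with | _ w hw
  intro h
  have h' := congrArg Subtype.val h
  rw [cp1ToSphere_mk, cp1ToSphere_mk] at h'
  have hv0 : hopf v.1 v.2 ≠ 0 := fun h => hv (Prod.ext_iff.2 (hopf_eq_zero_iff.1 h))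
  have hw0 : hopf w.1 w.2 ≠ 0 := fun h => hw (Prod.ext_iff.2 (hopf_eq_zero_iff.1 h))
  set s : ℝ := √(‖hopf v.1 v.2‖ / ‖hopf w.1 w.2‖) with hs
  have hs2 : s ^ 2 = ‖hopf v.1 v.2‖ / ‖hopf w.1 w.2‖ := Real.sq_sqrt (by positivity)
  have h2 : hopf v.1 v.2 = hopf ((s : ℂ) * w.1) ((s : ℂ) * w.2) := by
    rw [hopf_mul, Complex.norm_real, Real.norm_eq_abs, sq_abs, hs2, div_eq_mul_inv, mul_smul, ← h',
      smul_smul, mul_inv_cancel₀ (norm_ne_zero_iff.2 hv0), one_smul]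
  obtain ⟨c, hc1, hc2⟩ := hopf_eq_iff.1 h2
  rw [Projectivization.mk_eq_mk_iff']
  exact ⟨c * s, by ext1 <;> simp [hc1, hc2, mul_assoc]⟩

theorem cp1ToSphere_surjective : Function.Surjective cp1ToSphere := by
  rintro ⟨y, hy⟩
  obtain ⟨u, v, rfl⟩ := exists_hopf_eq y
  rw [mem_sphere_zero_iff_norm] at hy
  have hv : ((u, v) : ℂ × ℂ) ≠ 0 := by
    rintro h
    rw [Prod.mk_eq_zero] at h
    rw [hopf_eq_zero_iff.2 h, norm_zero] at hy
    exact zero_ne_one hy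
  refine ⟨Projectivization.mk ℂ (u, v) hv, Subtype.ext ?_⟩
  rw [cp1ToSphere_mk, hy, inv_one, one_smul]

instance : CompactSpace CP1 := by
  have hc : Continuous fun v : Metric.sphere (0 : ℂ × ℂ) 1 =>
      Projectivization.mk ℂ v.1 (ne_zero_of_mem_unit_sphere v) :=
    (continuous_coinduced_rng (f := fun v : {v : ℂ × ℂ // v ≠ 0} =>
      Projectivization.mk ℂ v.1 v.2)).comp
        (continuous_subtype_val.subtype_mk fun v => ne_zero_of_mem_unit_sphere v)
  have hs : Function.Surjective fun v : Metric.sphere (0 : ℂ × ℂ) 1 =>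
      Projectivization.mk ℂ v.1 (ne_zero_of_mem_unit_sphere v) := by
    intro p
    induction p using Projectivization.ind with | _ v hv
    have hn : ‖v‖ ≠ 0 := norm_ne_zero_iff.2 hv
    refine ⟨⟨((‖v‖⁻¹ : ℝ) : ℂ) • v, ?_⟩, ?_⟩
    · rw [mem_sphere_zero_iff_norm, norm_smul, Complex.norm_real, norm_inv, norm_norm,
        inv_mul_cancel₀ hn]
    · exact (Projectivization.mk_eq_mk_iff' _ _ _ _ _).2 ⟨_, rfl⟩
  exact hs.compactSpace hc

/-- The Hopf homeomorphism `ℂP¹ ≅ S²`. -/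
noncomputable def cp1Homeo : CP1 ≃ₜ Metric.sphere (0 : WithLp 2 (ℂ × ℝ)) 1 :=
  Continuous.homeoOfEquivCompactToT2
    (f := Equiv.ofBijective cp1ToSphere ⟨cp1ToSphere_injective, cp1ToSphere_surjective⟩)
    continuous_cp1ToSphere

/-! ### The join of two spheres -/

/-- The map `S(F) * S(E) → S(E ⊕ F)`, `(ζ, p, t) ↦ (√t p, √(1 - t) ζ)`; the sphere `S(E)` is
collapsed at the end `t = 0` of the join. -/
noncomputable def joinToSphere {X Y E F : Type*} [NormedAddCommGroup E] [NormedSpace ℝ E]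
    [NormedAddCommGroup F] [NormedSpace ℝ F] (f : X ≃ Metric.sphere (0 : F) 1)
    (g : Y ≃ Metric.sphere (0 : E) 1) :
    TopJoin X Y → Metric.sphere (0 : WithLp 2 (E × F)) 1 :=
  Quotient.lift
    (fun q => ⟨WithLp.toLp 2 (√(q.2.2 : ℝ) • (g q.2.1 : E), √(1 - (q.2.2 : ℝ)) • (f q.1 : F)), by
      rw [mem_sphere_zero_iff_norm, ← sq_eq_sq₀ (norm_nonneg _) zero_le_one,
        WithLp.prod_norm_sq_eq_of_L2]
      simp [norm_smul, Real.sq_sqrt q.2.2.2.1, Real.sq_sqrt (sub_nonneg.2 q.2.2.2.2)]⟩)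
    (by
      rintro ⟨x, y, t⟩ ⟨x', y', t'⟩ (h | ⟨h, h', h''⟩ | ⟨h, h', h''⟩)
      · rw [h]
      · dsimp only at h h' h''
        subst h h' h''
        simp
      · dsimp only at h h' h''
        subst h h' h''
        simp)

section Join

variable {X Y E F : Type*} [NormedAddCommGroup E] [NormedSpace ℝ E]
  [NormedAddCommGroup F] [NormedSpace ℝ F]

theorem joinToSphere_mk (f : X ≃ Metric.sphere (0 : F) 1) (g : Y ≃ Metric.sphere (0 : E) 1)
    (x : X) (y : Y) (t : unitInterval) :
    (joinToSphere f g (Quotient.mk _ (x, y, t)) : WithLp 2 (E × F)) =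
      WithLp.toLp 2 (√(t : ℝ) • (g y : E), √(1 - (t : ℝ)) • (f x : F)) := rfl

theorem continuous_joinToSphere [TopologicalSpace X] [TopologicalSpace Y]
    (f : X ≃ₜ Metric.sphere (0 : F) 1) (g : Y ≃ₜ Metric.sphere (0 : E) 1) :
    Continuous (joinToSphere f.toEquiv g.toEquiv) := by
  refine Continuous.quotient_lift ?_ _
  refine Continuous.subtype_mk ((WithLp.prod_continuous_toLp 2 E F).comp ?_) _
  have hf : Continuous fun x => (f x : F) := continuous_subtype_val.comp f.continuous
  have hg : Continuous fun y => (g y : E) := continuous_subtype_val.comp g.continuous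
  change Continuous fun q : X × Y × unitInterval =>
    (√(q.2.2 : ℝ) • (g q.2.1 : E), √(1 - (q.2.2 : ℝ)) • (f q.1 : F))
  fun_prop

theorem joinToSphere_injective (f : X ≃ Metric.sphere (0 : F) 1)
    (g : Y ≃ Metric.sphere (0 : E) 1) : Function.Injective (joinToSphere f g) := by
  intro p q
  induction p using Quotient.ind with | _ p
  induction q using Quotient.ind with | _ q
  obtain ⟨x, y, t⟩ := p
  obtain ⟨x', y', t'⟩ := q
  intro h
  have h' := congrArg (fun z => WithLp.ofLp (Subtype.val z)) h
  simp only [joinToSphere_mk, Prod.mk.injEq] at h'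
  obtain ⟨h1, h2⟩ := h'
  have ht : t = t' := by
    have := congrArg (fun z => ‖z‖ ^ 2) h1
    simp only [norm_smul, norm_eq_of_mem_sphere, mul_one, Real.norm_eq_abs, sq_abs,
      Real.sq_sqrt t.2.1, Real.sq_sqrt t'.2.1] at this
    exact Subtype.ext this
  subst ht
  have hy : t ≠ 0 → y = y' := by
    intro ht
    have h0 : √(t : ℝ) ≠ 0 := (Real.sqrt_pos.2 (unitInterval.pos_iff_ne_zero.2 ht)).ne'
    exact g.injective (Subtype.ext (smul_right_injective E h0 h1))
  have hx : t ≠ 1 → x = x' := by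
    intro ht
    have h0 : √(1 - (t : ℝ)) ≠ 0 :=
      (Real.sqrt_pos.2 (sub_pos.2 (unitInterval.lt_one_iff_ne_one.2 ht))).ne'
    exact f.injective (Subtype.ext (smul_right_injective F h0 h2))
  apply Quotient.sound
  by_cases h0 : t = 0
  · exact Or.inr (Or.inl ⟨h0, h0, hx (h0 ▸ zero_ne_one)⟩)
  · by_cases h1 : t = 1
    · exact Or.inr (Or.inr ⟨h1, h1, hy h0⟩)
    · exact Or.inl (by rw [hx h1, hy h0])

/-- Polar coordinates; nonemptiness provides a direction for the vector `0`. -/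
theorem exists_sphere_smul [Nonempty (Metric.sphere (0 : E) 1)] (v : E) :
    ∃ p : Metric.sphere (0 : E) 1, v = ‖v‖ • (p : E) := by
  by_cases hv : v = 0
  · exact ⟨Classical.arbitrary _, by simp [hv]⟩
  · refine ⟨⟨‖v‖⁻¹ • v, ?_⟩, ?_⟩
    · simpa using norm_smul_inv_norm (𝕜 := ℝ) hv
    · rw [smul_smul, mul_inv_cancel₀ (norm_ne_zero_iff.2 hv), one_smul]

theorem joinToSphere_surjective [Nonempty X] [Nonempty Y] (f : X ≃ Metric.sphere (0 : F) 1)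
    (g : Y ≃ Metric.sphere (0 : E) 1) : Function.Surjective (joinToSphere f g) := by
  rintro ⟨z, hz⟩
  have : Nonempty (Metric.sphere (0 : F) 1) := f.nonempty_congr.1 inferInstance
  have : Nonempty (Metric.sphere (0 : E) 1) := g.nonempty_congr.1 inferInstance
  rw [mem_sphere_zero_iff_norm] at hz
  have hz2 := WithLp.prod_norm_sq_eq_of_L2 z
  rw [hz, one_pow] at hz2
  obtain ⟨p, hp⟩ := exists_sphere_smul z.fst
  obtain ⟨q, hq⟩ := exists_sphere_smul z.snd
  refine ⟨Quotient.mk _ (f.symm q, g.symm p,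
    ⟨‖z.fst‖ ^ 2, by positivity, by nlinarith [sq_nonneg ‖z.snd‖]⟩), Subtype.ext ?_⟩
  rw [joinToSphere_mk]
  apply WithLp.ofLp_injective
  have h1 : (1 : ℝ) - ‖z.fst‖ ^ 2 = ‖z.snd‖ ^ 2 := by linarith
  simp only [Equiv.apply_symm_apply, h1, Real.sqrt_sq (norm_nonneg _), ← hp, ← hq]
  rfl

instance {X Y : Type*} [TopologicalSpace X] [TopologicalSpace Y] [CompactSpace X] [CompactSpace Y] :
    CompactSpace (TopJoin X Y) := Quotient.compactSpace

/-- The join of two spheres is the unit sphere of the direct sum. -/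
noncomputable def joinHomeo [TopologicalSpace X] [TopologicalSpace Y] [CompactSpace X]
    [CompactSpace Y] [Nonempty X] [Nonempty Y]
    (f : X ≃ₜ Metric.sphere (0 : F) 1) (g : Y ≃ₜ Metric.sphere (0 : E) 1) :
    TopJoin X Y ≃ₜ Metric.sphere (0 : WithLp 2 (E × F)) 1 :=
  Continuous.homeoOfEquivCompactToT2
    (f := Equiv.ofBijective (joinToSphere f.toEquiv g.toEquiv)
      ⟨joinToSphere_injective _ _, joinToSphere_surjective _ _⟩)
    (continuous_joinToSphere f g)

end Join

/-- The circle as the unit sphere of `ℂ`. -/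
noncomputable def circleHomeo : Circle ≃ₜ Metric.sphere (0 : ℂ) 1 := Homeomorph.refl _

theorem nonempty_sphere_homeo {E : Type*} [NormedAddCommGroup E] [InnerProductSpace ℝ E]
    [FiniteDimensional ℝ E] {n : ℕ} (h : Module.finrank ℝ E = n) :
    Nonempty (Metric.sphere (0 : E) 1 ≃ₜ Metric.sphere (0 : EuclideanSpace ℝ (Fin n)) 1) := by
  let e : E ≃ₗᵢ[ℝ] EuclideanSpace ℝ (Fin n) :=
    ((stdOrthonormalBasis ℝ E).reindex (finCongr h)).repr
  refine ⟨e.toHomeomorph.subtype fun x => ?_⟩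
  simp

theorem finrank_withLp_prod : Module.finrank ℝ (WithLp 2 (WithLp 2 (ℂ × ℝ) × ℂ)) = 5 := by
  rw [(WithLp.linearEquiv 2 ℝ (WithLp 2 (ℂ × ℝ) × ℂ)).finrank_eq, Module.finrank_prod,
    (WithLp.linearEquiv 2 ℝ (ℂ × ℝ)).finrank_eq, Module.finrank_prod]
  simp [Complex.finrank_real_complex]

instance : Nonempty CP1 := ⟨cp1Homeo.symm ⟨WithLp.toLp 2 (1, 0), by simp⟩⟩

theorem nonempty_join_homeo_sphere :
    Nonempty (TopJoin Circle CP1 ≃ₜ Metric.sphere (0 : WithLp 2 (WithLp 2 (ℂ × ℝ) × ℂ)) 1) :=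
  ⟨joinHomeo circleHomeo cp1Homeo⟩

/-! ### Unitary matrices and flags -/

instance compactSpace_unitaryGroup : CompactSpace (Matrix.unitaryGroup (Fin 3) ℂ) := by
  suffices hc : IsCompact {A : Matrix (Fin 3) (Fin 3) ℂ | A ∈ Matrix.unitaryGroup (Fin 3) ℂ} from
    isCompact_iff_compactSpace.1 hc
  refine IsCompact.of_isClosed_subset (isCompact_univ_pi fun i : Fin 3 => isCompact_univ_pi
    fun j : Fin 3 => isCompact_closedBall (0 : ℂ) 1) ?_ ?_
  · have h : {A : Matrix (Fin 3) (Fin 3) ℂ | A ∈ Matrix.unitaryGroup (Fin 3) ℂ} =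
        {A | A * star A = 1} := by
      ext A
      exact Matrix.mem_unitaryGroup_iff
    rw [h]
    exact isClosed_eq (by fun_prop) continuous_const
  · intro A hA i _ j _
    rw [mem_closedBall_zero_iff]
    exact entry_norm_bound_of_unitary hA i j

theorem unitary_cols_inner (A : Matrix.unitaryGroup (Fin 3) ℂ) (j k : Fin 3) :
    ∑ i, conj (A i j) * A i k = if j = k then 1 else 0 := by
  have h := congrFun (congrFun (Matrix.UnitaryGroup.star_mul_self A) j) k
  rw [Matrix.mul_apply, Matrix.one_apply] at h
  exact h

theorem unitary_col_norm (A : Matrix.unitaryGroup (Fin 3) ℂ) (j : Fin 3) :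
    ∑ i, ‖A i j‖ ^ 2 = 1 := by
  have h := unitary_cols_inner A j j
  simp only [Complex.conj_mul', if_true] at h
  exact_mod_cast h

theorem exists_unitary_cols (z n : Fin 3 → ℂ) (hz : ∑ i, ‖z i‖ ^ 2 = 1) (hn : ∑ i, ‖n i‖ ^ 2 = 1)
    (hzn : ∑ i, conj (n i) * z i = 0) :
    ∃ A : Matrix.unitaryGroup (Fin 3) ℂ, (∀ i, A i 0 = z i) ∧ ∀ i, A i 2 = n i := by
  set v : Fin 3 → EuclideanSpace ℂ (Fin 3) := ![WithLp.toLp 2 z, 0, WithLp.toLp 2 n] with hv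
  have h00 : inner ℂ (WithLp.toLp 2 z) (WithLp.toLp 2 z) = (1 : ℂ) := by
    have h := (EuclideanSpace.norm_sq_eq (WithLp.toLp 2 z)).trans hz
    rw [inner_self_eq_norm_sq_to_K, ← RCLike.ofReal_pow, h, RCLike.ofReal_one]
  have h22 : inner ℂ (WithLp.toLp 2 n) (WithLp.toLp 2 n) = (1 : ℂ) := by
    have h := (EuclideanSpace.norm_sq_eq (WithLp.toLp 2 n)).trans hn
    rw [inner_self_eq_norm_sq_to_K, ← RCLike.ofReal_pow, h, RCLike.ofReal_one]
  have h20 : inner ℂ (WithLp.toLp 2 n) (WithLp.toLp 2 z) = (0 : ℂ) := by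
    rw [← hzn, PiLp.inner_apply]
    exact Finset.sum_congr rfl fun i _ => mul_comm _ _
  have h02 : inner ℂ (WithLp.toLp 2 z) (WithLp.toLp 2 n) = (0 : ℂ) := inner_eq_zero_symm.1 h20
  have ho : Orthonormal ℂ (({0, 2} : Set (Fin 3)).domRestrict v) := by
    rw [orthonormal_iff_ite]
    rintro ⟨i, hi⟩ ⟨j, hj⟩
    rcases hi with rfl | rfl <;> rcases hj with rfl | rfl
    · simpa [Set.domRestrict, hv] using h00
    · rw [if_neg fun h => absurd (congrArg Subtype.val h) (by decide)]
      exact h02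
    · rw [if_neg fun h => absurd (congrArg Subtype.val h) (by decide)]
      exact h20
    · simpa [Set.domRestrict, hv] using h22
  obtain ⟨b, hb⟩ := ho.exists_orthonormalBasis_extension_of_card_eq (by simp)
  refine ⟨⟨_, (EuclideanSpace.basisFun (Fin 3) ℂ).toMatrix_orthonormalBasis_mem_unitary b⟩, ?_, ?_⟩
  · intro i
    change (EuclideanSpace.basisFun (Fin 3) ℂ).toBasis.toMatrix b i 0 = z i
    rw [Module.Basis.toMatrix_apply, hb 0 (by simp)]
    simp [hv]
  · intro i
    change (EuclideanSpace.basisFun (Fin 3) ℂ).toBasis.toMatrix b i 2 = n i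
    rw [Module.Basis.toMatrix_apply, hb 2 (by simp)]
    simp [hv]

/-- The functional `v ↦ ∑ n̄ᵢ vᵢ`. -/
noncomputable def conjDual (n : Fin 3 → ℂ) : (Fin 3 → ℂ) →ₗ[ℂ] ℂ :=
  ∑ i, conj (n i) • LinearMap.proj i

theorem conjDual_apply (n v : Fin 3 → ℂ) : conjDual n v = ∑ i, conj (n i) * v i := by
  simp [conjDual]

theorem col_mem_colSpan_one (A : Matrix.unitaryGroup (Fin 3) ℂ) :
    (fun i => A i 0) ∈ (unitaryFlag A).line :=
  Submodule.subset_span ⟨0, rfl⟩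

theorem mem_line_unitaryFlag {A : Matrix.unitaryGroup (Fin 3) ℂ} {v : Fin 3 → ℂ}
    (hv : v ∈ (unitaryFlag A).line) : ∃ a : ℂ, ∀ i, v i = a * A i 0 := by
  change v ∈ Submodule.span ℂ _ at hv
  rw [Set.range_unique, Submodule.mem_span_singleton] at hv
  obtain ⟨a, rfl⟩ := hv
  exact ⟨a, fun i => rfl⟩

theorem plane_unitaryFlag_le (A : Matrix.unitaryGroup (Fin 3) ℂ) :
    (unitaryFlag A).plane ≤ LinearMap.ker (conjDual fun i => A i 2) := by
  refine Submodule.span_le.2 ?_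
  rintro _ ⟨a, rfl⟩
  change conjDual _ _ = 0
  rw [conjDual_apply]
  refine (unitary_cols_inner A 2 (Fin.castLE (by norm_num) a)).trans (if_neg ?_)
  fin_cases a <;> decide

theorem finrank_ker_eq_two {f : (Fin 3 → ℂ) →ₗ[ℂ] ℂ} (hf : f ≠ 0) :
    Module.finrank ℂ (LinearMap.ker f) = 2 := by
  have h := Module.Dual.finrank_ker_add_one_of_ne_zero hf
  rw [Module.finrank_fin_fun] at h
  omega

/-- A flag is the flag of a unitary matrix as soon as its line contains the first column, and its
plane is orthogonal to the last one. -/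
theorem unitaryFlag_eq {A : Matrix.unitaryGroup (Fin 3) ℂ} {L : F3}
    (h1 : (fun i => A i 0) ∈ L.line) (h2 : ∀ v ∈ L.plane, ∑ i, conj (A i 2) * v i = 0) :
    unitaryFlag A = L := by
  have hn : conjDual (fun i => A i 2) ≠ 0 := by
    intro h
    have h' := unitary_cols_inner A 2 2
    rw [← conjDual_apply (fun i => A i 2) (fun i => A i 2), h] at h'
    simp at h'
  ext1
  · refine Submodule.eq_of_le_of_finrank_eq ?_ (by rw [F3.finrank_line, F3.finrank_line])
    intro v hv
    obtain ⟨a, ha⟩ := mem_line_unitaryFlag hv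
    have : v = a • fun i => A i 0 := funext ha
    rw [this]
    exact L.line.smul_mem _ h1
  · have e1 := Submodule.eq_of_le_of_finrank_eq (plane_unitaryFlag_le A)
      (by rw [F3.finrank_plane, finrank_ker_eq_two hn])
    have e2 : L.plane = LinearMap.ker (conjDual fun i => A i 2) := by
      refine Submodule.eq_of_le_of_finrank_eq (fun v hv => ?_)
        (by rw [F3.finrank_plane, finrank_ker_eq_two hn])
      rw [LinearMap.mem_ker, conjDual_apply]
      exact h2 v hv
    rw [e1, e2]

theorem exists_normalize {v : Fin 3 → ℂ} (hv : v ≠ 0) :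
    ∃ r : ℝ, ∑ i, ‖(r : ℂ) * v i‖ ^ 2 = 1 := by
  have h : 0 < ∑ i, ‖v i‖ ^ 2 := by
    obtain ⟨i, hi⟩ := Function.ne_iff.1 hv
    exact Finset.sum_pos' (fun i _ => by positivity)
      ⟨i, Finset.mem_univ _, pow_pos (norm_pos_iff.2 hi) _⟩
  refine ⟨(√(∑ i, ‖v i‖ ^ 2))⁻¹, ?_⟩
  simp only [norm_mul, mul_pow, Complex.norm_real, Real.norm_eq_abs, sq_abs]
  rw [← Finset.mul_sum, inv_pow, Real.sq_sqrt h.le, inv_mul_cancel₀ h.ne']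

theorem unitaryFlag_surjective : Function.Surjective unitaryFlag := by
  intro L
  obtain ⟨⟨z, hz⟩, hz0, -⟩ := finrank_eq_one_iff'.1 L.finrank_line
  have hz0' : z ≠ 0 := fun h => hz0 (Subtype.ext h)
  have hlt : L.plane < ⊤ := by
    refine lt_top_iff_ne_top.2 fun h => ?_
    have := L.finrank_plane
    rw [h, finrank_top, Module.finrank_fin_fun] at this
    omega
  obtain ⟨f, hf0, hf⟩ := Submodule.exists_le_ker_of_lt_top _ hlt
  have hfs : ∀ v, f v = ∑ i, f (Pi.single i 1) * v i := by
    intro v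
    conv_lhs => rw [LinearMap.pi_apply_eq_sum_univ f v]
    refine Finset.sum_congr rfl fun i _ => ?_
    rw [smul_eq_mul, mul_comm]
    congr 2
    ext j
    simp [Pi.single_apply, eq_comm]
  set n : Fin 3 → ℂ := fun i => conj (f (Pi.single i 1)) with hn
  have hn0 : n ≠ 0 := by
    intro h
    apply hf0
    refine LinearMap.ext fun v => ?_
    have : ∀ i, f (Pi.single i 1) = 0 := fun i => by
      simpa [hn] using congrFun h i
    rw [hfs]
    simp [this]
  obtain ⟨r, hr⟩ := exists_normalize hz0'
  obtain ⟨s, hs⟩ := exists_normalize hn0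
  have hort : ∀ v ∈ L.plane, ∑ i, conj ((s : ℂ) * n i) * v i = 0 := by
    intro v hv
    have : f v = 0 := hf hv
    rw [hfs] at this
    simp only [hn, map_mul, Complex.conj_ofReal, Complex.conj_conj, mul_assoc]
    rw [← Finset.mul_sum, this, mul_zero]
  have hrz : (fun i => (r : ℂ) * z i) ∈ L.line := L.line.smul_mem (r : ℂ) hz
  obtain ⟨A, hA0, hA2⟩ := exists_unitary_cols (fun i => (r : ℂ) * z i) (fun i => (s : ℂ) * n i)
    hr hs (hort _ (L.line_le_plane hrz))
  refine ⟨A, unitaryFlag_eq ?_ ?_⟩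
  · simpa only [hA0] using hrz
  · simpa only [hA2] using hort

/-- The projection `U(3) → F₃/T²`. -/
noncomputable def orbitProj (A : Matrix.unitaryGroup (Fin 3) ℂ) : OrbitSpace :=
  Quotient.mk _ (unitaryFlag A)

theorem isQuotientMap_orbitProj : IsQuotientMap orbitProj :=
  isQuotientMap_quotient_mk'.comp ⟨⟨rfl⟩, unitaryFlag_surjective⟩

instance : CompactSpace OrbitSpace :=
  isQuotientMap_orbitProj.surjective.compactSpace isQuotientMap_orbitProj.continuous

/-- The columns of unitary matrices over the same orbit: `T³` acts on the rows, and the circles of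
the lines `L₁` and `L₂^⊥` act on the first and the last column; one of these circles is absorbed
into `T³`. -/
theorem orbitProj_eq_iff {A B : Matrix.unitaryGroup (Fin 3) ℂ} :
    orbitProj A = orbitProj B ↔ ∃ (c : Circle) (t : Fin 3 → Circle),
      (∀ i, A i 0 = t i * (c * B i 0)) ∧ ∀ i, A i 2 = t i * B i 2 := by
  constructor
  · intro h
    obtain ⟨t, ht⟩ := Quotient.exact h
    induction t using QuotientGroup.induction_on with | H t
    change t • unitaryFlag B = unitaryFlag A at ht
    obtain ⟨a, ha⟩ : ∃ a : ℂ, ∀ i, A i 0 = a * (t i * B i 0) := by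
      have h1 := col_mem_colSpan_one A
      rw [← ht, F3.smul_line] at h1
      obtain ⟨w, hw, hw'⟩ := h1
      obtain ⟨a, ha⟩ := mem_line_unitaryFlag hw
      refine ⟨a, fun i => ?_⟩
      rw [← congrFun hw' i]
      change (t i : ℂ) * w i = _
      rw [ha]
      ring
    -- the last column of `A`, moved back by `t`, is orthogonal to the first two columns of `B`
    obtain ⟨d, hd⟩ : ∃ d : ℂ, ∀ i, conj (t i : ℂ) * A i 2 = d * B i 2 := by
      have h2 : ∀ j : Fin 2, ∑ i, conj (B i (Fin.castLE (by norm_num : 2 ≤ 3) j)) *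
          (conj (t i : ℂ) * A i 2) = 0 := by
        intro j
        have h3 : diagEquiv t (fun i => B i (Fin.castLE (by norm_num : 2 ≤ 3) j)) ∈
            (unitaryFlag A).plane := by
          rw [← ht, F3.smul_plane]
          exact Submodule.mem_map_of_mem (Submodule.subset_span ⟨j, rfl⟩)
        have h4 := plane_unitaryFlag_le A h3
        rw [LinearMap.mem_ker, conjDual_apply] at h4
        have h5 := congrArg conj h4
        rw [map_sum, map_zero] at h5
        rw [← h5]
        refine Finset.sum_congr rfl fun i _ => ?_
        rw [diagEquiv_apply]
        simp only [map_mul, Complex.conj_conj]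
        ring
      have h6 : (B : Matrix (Fin 3) (Fin 3) ℂ).mulVec ((star (B : Matrix (Fin 3) (Fin 3) ℂ)).mulVec
          fun i => conj (t i : ℂ) * A i 2) = fun i => conj (t i : ℂ) * A i 2 := by
        rw [Matrix.mulVec_mulVec, Matrix.mem_unitaryGroup_iff.1 B.2, Matrix.one_mulVec]
      refine ⟨∑ i, conj (B i 2) * (conj (t i : ℂ) * A i 2), fun i => ?_⟩
      have h7 := congrFun h6 i
      have e0 : (star (B : Matrix (Fin 3) (Fin 3) ℂ)).mulVec
          (fun i => conj (t i : ℂ) * A i 2) 0 = 0 := h2 0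
      have e1 : (star (B : Matrix (Fin 3) (Fin 3) ℂ)).mulVec
          (fun i => conj (t i : ℂ) * A i 2) 1 = 0 := h2 1
      rw [← h7]
      conv_lhs => rw [Matrix.mulVec, dotProduct, Fin.sum_univ_three, e0, e1]
      rw [mul_zero, mul_zero, zero_add, zero_add, mul_comm]
      rfl
    have ha1 : ‖a‖ = 1 := by
      have h1 := unitary_col_norm A 0
      simp only [ha, norm_mul, Circle.norm_coe, one_mul, mul_pow] at h1
      rw [← Finset.mul_sum, unitary_col_norm B 0, mul_one] at h1
      exact (pow_eq_one_iff_of_nonneg (norm_nonneg _) two_ne_zero).1 h1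
    have hd' : ∀ i, A i 2 = d * (t i * B i 2) := by
      intro i
      have : (t i : ℂ) * conj (t i : ℂ) = 1 := by
        rw [Complex.mul_conj', Circle.norm_coe]; norm_num
      linear_combination (t i : ℂ) * hd i - A i 2 * this
    have hd1 : ‖d‖ = 1 := by
      have h1 := unitary_col_norm A 2
      simp only [hd', norm_mul, Circle.norm_coe, one_mul, mul_pow] at h1
      rw [← Finset.mul_sum, unitary_col_norm B 2, mul_one] at h1
      exact (pow_eq_one_iff_of_nonneg (norm_nonneg _) two_ne_zero).1 h1
    obtain ⟨a, rfl⟩ : ∃ a' : Circle, (a' : ℂ) = a := ⟨⟨a, mem_sphere_zero_iff_norm.2 ha1⟩, rfl⟩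
    obtain ⟨d, rfl⟩ : ∃ d' : Circle, (d' : ℂ) = d := ⟨⟨d, mem_sphere_zero_iff_norm.2 hd1⟩, rfl⟩
    refine ⟨d⁻¹ * a, fun i => d * t i, fun i => ?_, fun i => ?_⟩
    · rw [ha]
      have : (d : ℂ) ≠ 0 := Circle.coe_ne_zero d
      push_cast
      field_simp
    · rw [hd']
      push_cast
      ring
  · rintro ⟨c, t, h0, h2⟩
    refine Quotient.sound ⟨(t : Torus2), ?_⟩
    change t • unitaryFlag B = unitaryFlag A
    symm
    apply unitaryFlag_eq
    · rw [F3.smul_line]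
      refine ⟨(c : ℂ) • fun i => B i 0, Submodule.smul_mem _ _ (col_mem_colSpan_one B), ?_⟩
      funext i
      exact (h0 i).symm
    · rw [F3.smul_plane]
      rintro _ ⟨w, hw, rfl⟩
      have h3 := plane_unitaryFlag_le B hw
      rw [LinearMap.mem_ker, conjDual_apply] at h3
      rw [← h3]
      refine Finset.sum_congr rfl fun i _ => ?_
      change conj (A i 2) * ((t i : ℂ) * w i) = _
      have : conj (t i : ℂ) * (t i : ℂ) = 1 := by
        rw [Complex.conj_mul', Circle.norm_coe]; norm_num
      rw [h2, map_mul]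
      linear_combination conj (B i 2) * w i * this

/-! ### Effectiveness of the torus action -/

theorem faithfulSMul_torus : FaithfulSMul Torus2 F3 := by
  refine ⟨fun {s t} h => ?_⟩
  induction s using QuotientGroup.induction_on with | H s
  induction t using QuotientGroup.induction_on with | H t
  rw [QuotientGroup.eq]
  -- a flag whose line is spanned by a vector without zero coordinates
  obtain ⟨r, hr⟩ := exists_normalize (v := fun _ => 1) (fun h => one_ne_zero (congrFun h 0))
  obtain ⟨r', hr'⟩ := exists_normalize (v := ![1, -1, 0]) (fun h => one_ne_zero (congrFun h 0))
  obtain ⟨A, hA, -⟩ := exists_unitary_cols _ _ hr hr' (by simp [Fin.sum_univ_three])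
  have hr0 : (r : ℂ) ≠ 0 := by
    intro h0
    simp [h0] at hr
  have hm : diagEquiv s (fun i => A i 0) ∈ (s • unitaryFlag A).line :=
    Submodule.mem_map_of_mem (col_mem_colSpan_one A)
  have hst : s • unitaryFlag A = t • unitaryFlag A := h (unitaryFlag A)
  rw [hst, F3.smul_line] at hm
  obtain ⟨w, hw, hw'⟩ := hm
  obtain ⟨a, ha⟩ := mem_line_unitaryFlag hw
  have key : ∀ i, (t i : ℂ) * a = s i := by
    intro i
    have h1 : (t i : ℂ) * w i = s i * A i 0 := congrFun hw' i
    rw [ha, hA, mul_one, ← mul_assoc] at h1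
    exact mul_right_cancel₀ hr0 h1
  have ha0 : a ≠ 0 := by
    rintro rfl
    exact Circle.coe_ne_zero (s 0) (by rw [← key 0, mul_zero])
  have hdiag : ∀ i, ((s⁻¹ * t) i : Circle) = ((s⁻¹ * t) 0 : Circle) := by
    intro i
    apply Circle.ext
    have e : ∀ i, (((s⁻¹ * t) i : Circle) : ℂ) = a⁻¹ := by
      intro i
      have := Circle.coe_ne_zero (t i)
      rw [Pi.mul_apply, Pi.inv_apply, Circle.coe_mul, Circle.coe_inv, ← key i]
      field_simp
    rw [e, e]
  intro i j
  rw [hdiag i, hdiag j]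

/-! ### The orbit space as a space of triangles -/

/-- The three vectors of `ℂ × ℝ` attached to a unitary matrix by applying the Hopf map to the first
and the last entry of each row: the sides of a triangle of perimeter `2`. -/
noncomputable def side (A : Matrix.unitaryGroup (Fin 3) ℂ) (i : Fin 3) : WithLp 2 (ℂ × ℝ) :=
  hopf (A i 0) (A i 2)

theorem continuous_side (i : Fin 3) : Continuous fun A => side A i := by
  have h : ∀ j : Fin 3, Continuous fun A : Matrix.unitaryGroup (Fin 3) ℂ => A i j := fun j =>
    (continuous_subtype_val (p := fun A => A ∈ Matrix.unitaryGroup (Fin 3) ℂ)).matrix_elem i j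
  exact continuous_hopf.comp ((h 0).prodMk (h 2))

theorem sum_side_fst (A : Matrix.unitaryGroup (Fin 3) ℂ) : ∑ i, (side A i).fst = 0 := by
  have h := unitary_cols_inner A 2 0
  rw [if_neg (by decide)] at h
  simp only [side, hopf_fst]
  rw [← mul_zero (2 : ℂ), ← h, Finset.mul_sum]
  exact Finset.sum_congr rfl fun i _ => by ring

theorem sum_side_snd (A : Matrix.unitaryGroup (Fin 3) ℂ) : ∑ i, (side A i).snd = 0 := by
  simp only [side, hopf_snd]
  rw [Finset.sum_sub_distrib, unitary_col_norm, unitary_col_norm, sub_self]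

theorem sum_norm_side (A : Matrix.unitaryGroup (Fin 3) ℂ) : ∑ i, ‖side A i‖ = 2 := by
  simp only [side, norm_hopf]
  rw [Finset.sum_add_distrib, unitary_col_norm, unitary_col_norm, one_add_one_eq_two]

/-- Every triangle of perimeter `2` in `ℂ × ℝ` comes from a unitary matrix. -/
theorem exists_side_eq (y : Fin 3 → WithLp 2 (ℂ × ℝ)) (h1 : ∑ i, (y i).fst = 0)
    (h2 : ∑ i, (y i).snd = 0) (h3 : ∑ i, ‖y i‖ = 2) : ∃ A, ∀ i, side A i = y i := by
  choose z n hzn using fun i => exists_hopf_eq (y i)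
  simp only [← hzn, hopf_fst, hopf_snd, norm_hopf, Finset.sum_add_distrib,
    Finset.sum_sub_distrib] at h1 h2 h3
  obtain ⟨A, hA0, hA2⟩ := exists_unitary_cols z n (by linarith) (by linarith) (by
    refine mul_left_cancel₀ (two_ne_zero (α := ℂ)) ?_
    rw [mul_zero, ← h1, Finset.mul_sum]
    exact Finset.sum_congr rfl fun i _ => by ring)
  exact ⟨A, fun i => by rw [side, hA0, hA2, hzn]⟩

/-- The orbit of a flag is the triangle of its sides, up to rotations about the axis `ℝ`. -/
theorem orbitProj_eq_iff_side {A B : Matrix.unitaryGroup (Fin 3) ℂ} :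
    orbitProj A = orbitProj B ↔ ∃ c : Circle, ∀ i,
      (side A i).fst = c * (side B i).fst ∧ (side A i).snd = (side B i).snd := by
  have key : ∀ (c : Circle) (i : Fin 3), ((side A i).fst = c * (side B i).fst ∧
      (side A i).snd = (side B i).snd) ↔ side A i = hopf (c * B i 0) (B i 2) := by
    intro c i
    rw [← (WithLp.ofLp_injective 2).eq_iff, Prod.ext_iff]
    change _ ↔ (side A i).fst = _ ∧ (side A i).snd = (hopf _ _).snd
    rw [hopf_snd, norm_mul, Circle.norm_coe, one_mul]
    change _ ↔ _ = (hopf _ _).fst ∧ _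
    rw [hopf_fst, side, side, hopf_fst, hopf_fst, hopf_snd, hopf_snd]
    ring_nf
  rw [orbitProj_eq_iff]
  refine exists_congr fun c => ?_
  rw [forall_congr' (key c)]
  simp only [side, hopf_eq_iff, ← forall_and]
  exact (Classical.skolem (p := fun (i : Fin 3) (t : Circle) =>
    A i 0 = t * (c * B i 0) ∧ A i 2 = t * B i 2)).symm

/-- The perimeter of the triangle in `ℂ × ℝ` with the sides `(w₀, Re x)`, `(w₁, Im x)` and minus
their sum. -/
noncomputable def perimeter (w₀ w₁ x : ℂ) : ℝ :=
  ‖(WithLp.toLp 2 (w₀, x.re) : WithLp 2 (ℂ × ℝ))‖ +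
    ‖(WithLp.toLp 2 (w₁, x.im) : WithLp 2 (ℂ × ℝ))‖ +
    ‖(WithLp.toLp 2 (w₀ + w₁, x.re + x.im) : WithLp 2 (ℂ × ℝ))‖

theorem norm_toLp_pair (w : ℂ) (r : ℝ) :
    ‖(WithLp.toLp 2 (w, r) : WithLp 2 (ℂ × ℝ))‖ = √(‖w‖ ^ 2 + r ^ 2) := by
  rw [WithLp.prod_norm_eq_of_L2]
  simp

theorem continuous_perimeter_scale (w₀ w₁ x : ℂ) :
    Continuous fun s : ℝ => perimeter (s * w₀) (s * w₁) x := by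
  simp only [perimeter, norm_toLp_pair]
  fun_prop

theorem perimeter_circle_mul (c : Circle) (w₀ w₁ x : ℂ) :
    perimeter (c * w₀) (c * w₁) x = perimeter w₀ w₁ x := by
  simp only [perimeter, norm_toLp_pair, ← mul_add, norm_mul, Circle.norm_coe, one_mul]

theorem perimeter_smul {s : ℝ} (hs : 0 ≤ s) (w₀ w₁ x : ℂ) :
    perimeter (s * w₀) (s * w₁) (s * x) = s * perimeter w₀ w₁ x := by
  have h : ∀ (w : ℂ) (r : ℝ), ‖(WithLp.toLp 2 ((s : ℂ) * w, s * r) : WithLp 2 (ℂ × ℝ))‖ =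
      s * ‖(WithLp.toLp 2 (w, r) : WithLp 2 (ℂ × ℝ))‖ := by
    intro w r
    rw [norm_toLp_pair, norm_toLp_pair, norm_mul, Complex.norm_real, Real.norm_eq_abs, mul_pow,
      mul_pow, sq_abs, ← mul_add, Real.sqrt_mul (sq_nonneg s), Real.sqrt_sq hs]
  simp only [perimeter, Complex.re_ofReal_mul, Complex.im_ofReal_mul, ← mul_add, h]

theorem perimeter_pos {w₀ w₁ x : ℂ} (h : ¬(w₀ = 0 ∧ w₁ = 0 ∧ x = 0)) : 0 < perimeter w₀ w₁ x := by
  by_contra hle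
  apply h
  rw [perimeter] at hle
  have h0 := norm_nonneg (WithLp.toLp 2 (w₀, x.re) : WithLp 2 (ℂ × ℝ))
  have h1 := norm_nonneg (WithLp.toLp 2 (w₁, x.im) : WithLp 2 (ℂ × ℝ))
  have h2 := norm_nonneg (WithLp.toLp 2 (w₀ + w₁, x.re + x.im) : WithLp 2 (ℂ × ℝ))
  have e0 := congrArg WithLp.ofLp (norm_eq_zero.1 (le_antisymm (by linarith) h0))
  have e1 := congrArg WithLp.ofLp (norm_eq_zero.1 (le_antisymm (by linarith) h1))
  rw [WithLp.ofLp_zero, Prod.mk_eq_zero] at e0 e1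
  exact ⟨e0.1, e1.1, Complex.ext e0.2 e1.2⟩

/-- The complete invariant of `T²`-orbits, on unitary matrices: the triangle of sides, described by
two of them and up to rotation. -/
noncomputable def sideInvariant (A : Matrix.unitaryGroup (Fin 3) ℂ) : WithLp 2 (ℂ × ℝ) × ℂ :=
  (hopf (side A 0).fst (side A 1).fst, ⟨(side A 0).snd, (side A 1).snd⟩)

theorem continuous_sideInvariant : Continuous sideInvariant := by
  have h1 : ∀ i, Continuous fun A => (side A i).fst := fun i =>
    (WithLp.continuous_fst 2 ℂ ℝ).comp (continuous_side i)
  have h2 : ∀ i, Continuous fun A => (side A i).snd := fun i =>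
    (WithLp.continuous_snd 2 ℂ ℝ).comp (continuous_side i)
  refine (continuous_hopf.comp ((h1 0).prodMk (h1 1))).prodMk ?_
  exact Complex.equivRealProdCLM.symm.continuous.comp ((h2 0).prodMk (h2 1))

theorem sideInvariant_eq_iff {A B : Matrix.unitaryGroup (Fin 3) ℂ} :
    sideInvariant A = sideInvariant B ↔ orbitProj A = orbitProj B := by
  rw [orbitProj_eq_iff_side, sideInvariant, sideInvariant, Prod.mk.injEq, hopf_eq_iff,
    ← exists_and_right]
  refine exists_congr fun c => ?_
  have hA := sum_side_fst A
  have hB := sum_side_fst B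
  have hA' := sum_side_snd A
  have hB' := sum_side_snd B
  rw [Fin.sum_univ_three] at hA hB hA' hB'
  rw [show (Complex.mk (side A 0).snd (side A 1).snd = ⟨(side B 0).snd, (side B 1).snd⟩) ↔ _ from
    Complex.ext_iff, Fin.forall_fin_succ, Fin.forall_fin_two]
  simp only [Fin.succ_zero_eq_one, Fin.succ_one_eq_two]
  constructor
  · rintro ⟨⟨h0, h1⟩, h2, h3⟩
    exact ⟨⟨h0, h2⟩, ⟨h1, h3⟩, by linear_combination hA - c * hB - h0 - h1, by linarith⟩
  · rintro ⟨⟨h0, h2⟩, ⟨h1, h3⟩, -⟩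
    exact ⟨⟨h0, h1⟩, h2, h3⟩

/-- The complete invariant of `T²`-orbits on the orbit space. -/
noncomputable def orbitInvariant : C(OrbitSpace, WithLp 2 (ℂ × ℝ) × ℂ) :=
  isQuotientMap_orbitProj.lift (f := ⟨orbitProj, isQuotientMap_orbitProj.continuous⟩)
    ⟨sideInvariant, continuous_sideInvariant⟩ fun _ _ h => sideInvariant_eq_iff.2 h

theorem orbitInvariant_orbitProj (A : Matrix.unitaryGroup (Fin 3) ℂ) :
    orbitInvariant (orbitProj A) = sideInvariant A :=
  congrFun (congrArg DFunLike.coe (isQuotientMap_orbitProj.lift_comp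
    (f := ⟨orbitProj, isQuotientMap_orbitProj.continuous⟩)
    ⟨sideInvariant, continuous_sideInvariant⟩ fun _ _ h => sideInvariant_eq_iff.2 h)) A

theorem orbitInvariant_injective : Function.Injective orbitInvariant := by
  intro p q h
  obtain ⟨A, rfl⟩ := isQuotientMap_orbitProj.surjective p
  obtain ⟨B, rfl⟩ := isQuotientMap_orbitProj.surjective q
  rw [orbitInvariant_orbitProj, orbitInvariant_orbitProj] at h
  exact sideInvariant_eq_iff.1 h

theorem exists_orbitInvariant_eq {w₀ w₁ x : ℂ} (h : perimeter w₀ w₁ x = 2) :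
    ∃ p, orbitInvariant p = (hopf w₀ w₁, x) := by
  obtain ⟨A, hA⟩ := exists_side_eq ![WithLp.toLp 2 (w₀, x.re), WithLp.toLp 2 (w₁, x.im),
    -WithLp.toLp 2 (w₀ + w₁, x.re + x.im)] (by simp [Fin.sum_univ_three])
    (by simp [Fin.sum_univ_three]) (by
      rw [Fin.sum_univ_three, ← h]
      simp only [Matrix.cons_val, norm_neg]
      rfl)
  refine ⟨orbitProj A, ?_⟩
  rw [orbitInvariant_orbitProj, sideInvariant, hA, hA]
  rfl

theorem exists_perimeter_eq (p : OrbitSpace) :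
    ∃ w₀ w₁ x : ℂ, perimeter w₀ w₁ x = 2 ∧ orbitInvariant p = (hopf w₀ w₁, x) := by
  obtain ⟨A, rfl⟩ := isQuotientMap_orbitProj.surjective p
  refine ⟨(side A 0).fst, (side A 1).fst, ⟨(side A 0).snd, (side A 1).snd⟩, ?_,
    orbitInvariant_orbitProj A⟩
  have h1 := sum_side_fst A
  have h2 := sum_side_snd A
  rw [Fin.sum_univ_three] at h1 h2
  have e : side A 2 = -WithLp.toLp 2 ((side A 0).fst + (side A 1).fst,
      (side A 0).snd + (side A 1).snd) := by
    apply WithLp.ofLp_injective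
    ext1
    · exact eq_neg_of_add_eq_zero_right h1
    · exact eq_neg_of_add_eq_zero_right h2
  rw [← sum_norm_side A, Fin.sum_univ_three, e, norm_neg]
  rfl

/-! ### The orbit space is a sphere -/

/-- The vector `(p, |x| x)` for the invariant `(p, x)` of an orbit. Scaling a triangle by `r`
multiplies `p` by `r²`, and `|x| x` is a homogeneous substitute for `x` of the same degree. -/
noncomputable def sphereVector (q : WithLp 2 (ℂ × ℝ) × ℂ) : WithLp 2 (WithLp 2 (ℂ × ℝ) × ℂ) :=
  WithLp.toLp 2 (q.1, ‖q.2‖ • q.2)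

theorem continuous_sphereVector : Continuous sphereVector :=
  (WithLp.prod_continuous_toLp 2 _ _).comp (by fun_prop)

theorem norm_smul_self_injective {E : Type*} [NormedAddCommGroup E] [NormedSpace ℝ E] :
    Function.Injective fun x : E => ‖x‖ • x := by
  intro x y h
  have hn : ‖x‖ = ‖y‖ := by
    have := congrArg norm h
    simp only [norm_smul, norm_norm, ← sq] at this
    exact (sq_eq_sq₀ (norm_nonneg _) (norm_nonneg _)).1 this
  by_cases hy : y = 0
  · rwa [hy, norm_zero, norm_eq_zero, ← hy] at hn
  · dsimp only at h
    rw [hn] at h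
    exact smul_right_injective E (norm_ne_zero_iff.2 hy) h

theorem sphereVector_injective : Function.Injective sphereVector := by
  intro q q' h
  have h' := congrArg WithLp.ofLp h
  simp only [sphereVector, Prod.mk.injEq] at h'
  exact Prod.ext h'.1 (norm_smul_self_injective h'.2)

theorem exists_sphereVector_eq (z : WithLp 2 (WithLp 2 (ℂ × ℝ) × ℂ)) :
    ∃ w₀ w₁ x, sphereVector (hopf w₀ w₁, x) = z := by
  obtain ⟨w₀, w₁, h⟩ := exists_hopf_eq z.fst
  refine ⟨w₀, w₁, ((√‖z.snd‖)⁻¹ : ℝ) • z.snd, ?_⟩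
  apply WithLp.ofLp_injective
  refine Prod.ext h ?_
  change ‖((√‖z.snd‖)⁻¹ : ℝ) • z.snd‖ • ((√‖z.snd‖)⁻¹ : ℝ) • z.snd = z.snd
  by_cases hz : z.snd = 0
  · simp [hz]
  · have hp : 0 < ‖z.snd‖ := norm_pos_iff.2 hz
    have hs : 0 < √‖z.snd‖ := Real.sqrt_pos.2 hp
    rw [norm_smul, smul_smul, norm_inv, Real.norm_eq_abs, abs_of_pos hs]
    have h2 : √‖z.snd‖ ^ 2 = ‖z.snd‖ := Real.sq_sqrt hp.le
    have : (√‖z.snd‖)⁻¹ * ‖z.snd‖ * (√‖z.snd‖)⁻¹ = 1 := by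
      field_simp
      exact h2.symm
    rw [this, one_smul]

theorem sphereVector_smul {s : ℝ} (hs : 0 ≤ s) (w₀ w₁ x : ℂ) :
    sphereVector (hopf (s * w₀) (s * w₁), s * x) = s ^ 2 • sphereVector (hopf w₀ w₁, x) := by
  apply WithLp.ofLp_injective
  refine Prod.ext ?_ ?_
  · change hopf _ _ = s ^ 2 • hopf _ _
    rw [hopf_mul, Complex.norm_real, Real.norm_eq_abs, sq_abs]
  · change ‖(s : ℂ) * x‖ • ((s : ℂ) * x) = s ^ 2 • ‖x‖ • x
    rw [norm_mul, Complex.norm_real, Real.norm_eq_abs, abs_of_nonneg hs]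
    simp only [Complex.real_smul]
    push_cast
    ring

theorem sphereVector_eq_zero {w₀ w₁ x : ℂ} (h : sphereVector (hopf w₀ w₁, x) = 0) :
    w₀ = 0 ∧ w₁ = 0 ∧ x = 0 := by
  have h' : sphereVector (hopf w₀ w₁, x) = sphereVector (hopf 0 0, 0) := by
    rw [h, hopf_eq_zero_iff.2 ⟨rfl, rfl⟩]
    simp only [sphereVector, norm_zero, zero_smul]
    rfl
  have h2 := sphereVector_injective h'
  rw [hopf_eq_zero_iff.2 ⟨rfl, rfl⟩, Prod.mk.injEq, hopf_eq_zero_iff] at h2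
  tauto

theorem perimeter_eq_of_sphereVector_eq {w₀ w₁ x w₀' w₁' x' : ℂ}
    (h : sphereVector (hopf w₀ w₁, x) = sphereVector (hopf w₀' w₁', x')) :
    perimeter w₀ w₁ x = perimeter w₀' w₁' x' := by
  have h2 := sphereVector_injective h
  rw [Prod.mk.injEq, hopf_eq_iff] at h2
  obtain ⟨⟨c, rfl, rfl⟩, rfl⟩ := h2
  exact perimeter_circle_mul c _ _ _

theorem sphereVector_orbitInvariant_ne_zero (p : OrbitSpace) :
    sphereVector (orbitInvariant p) ≠ 0 := by
  obtain ⟨w₀, w₁, x, hp, h⟩ := exists_perimeter_eq p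
  rw [h]
  intro h0
  obtain ⟨rfl, rfl, rfl⟩ := sphereVector_eq_zero h0
  simp [perimeter] at hp

/-- The radial projection of the orbit space to the unit sphere. -/
noncomputable def orbitToSphere (p : OrbitSpace) :
    Metric.sphere (0 : WithLp 2 (WithLp 2 (ℂ × ℝ) × ℂ)) 1 :=
  ⟨‖sphereVector (orbitInvariant p)‖⁻¹ • sphereVector (orbitInvariant p), by
    simpa using norm_smul_inv_norm (𝕜 := ℝ) (sphereVector_orbitInvariant_ne_zero p)⟩

theorem continuous_orbitToSphere : Continuous orbitToSphere := by
  have h : Continuous fun p => sphereVector (orbitInvariant p) :=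
    continuous_sphereVector.comp orbitInvariant.continuous
  exact ((h.norm.inv₀ fun p => norm_ne_zero_iff.2
    (sphereVector_orbitInvariant_ne_zero p)).smul h).subtype_mk _

theorem orbitToSphere_injective : Function.Injective orbitToSphere := by
  intro p q hpq
  apply orbitInvariant_injective
  apply sphereVector_injective
  have h := congrArg Subtype.val hpq
  change ‖sphereVector (orbitInvariant p)‖⁻¹ • sphereVector (orbitInvariant p) =
    ‖sphereVector (orbitInvariant q)‖⁻¹ • sphereVector (orbitInvariant q) at h
  have hp0 := sphereVector_orbitInvariant_ne_zero p
  have hq0 := sphereVector_orbitInvariant_ne_zero q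
  obtain ⟨w₀, w₁, x, hp, hp'⟩ := exists_perimeter_eq p
  obtain ⟨v₀, v₁, y, hq, hq'⟩ := exists_perimeter_eq q
  rw [hp'] at h hp0 ⊢
  rw [hq'] at h hq0 ⊢
  set P := sphereVector (hopf w₀ w₁, x) with hP
  set Q := sphereVector (hopf v₀ v₁, y) with hQ
  set s := √(‖P‖ / ‖Q‖) with hs
  have hs2 : s ^ 2 = ‖P‖ / ‖Q‖ := Real.sq_sqrt (by positivity)
  have h1 : P = s ^ 2 • Q := by
    rw [hs2, div_eq_mul_inv, mul_smul, ← h, smul_smul, mul_inv_cancel₀ (norm_ne_zero_iff.2 hp0),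
      one_smul]
  -- the perimeter is homogeneous of degree one, so the factor `s` is one
  have h2 : perimeter w₀ w₁ x = s * perimeter v₀ v₁ y := by
    rw [← perimeter_smul (Real.sqrt_nonneg _)]
    apply perimeter_eq_of_sphereVector_eq
    rw [sphereVector_smul (Real.sqrt_nonneg _)]
    exact h1
  rw [hp, hq] at h2
  have h3 : s = 1 := by linarith
  rw [h1, h3, one_pow, one_smul]

theorem orbitToSphere_surjective : Function.Surjective orbitToSphere := by
  rintro ⟨z, hz⟩
  rw [mem_sphere_zero_iff_norm] at hz
  obtain ⟨w₀, w₁, x, h⟩ := exists_sphereVector_eq z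
  have hpos : 0 < perimeter w₀ w₁ x := by
    apply perimeter_pos
    rintro ⟨rfl, rfl, rfl⟩
    rw [hopf_eq_zero_iff.2 ⟨rfl, rfl⟩] at h
    rw [← h] at hz
    simp [sphereVector] at hz
  have hs : 0 < 2 / perimeter w₀ w₁ x := by positivity
  set s := 2 / perimeter w₀ w₁ x with hs'
  obtain ⟨p, hp⟩ := exists_orbitInvariant_eq (w₀ := s * w₀) (w₁ := s * w₁) (x := s * x) (by
    rw [perimeter_smul hs.le, hs']
    field_simp)
  refine ⟨p, Subtype.ext ?_⟩
  change ‖sphereVector (orbitInvariant p)‖⁻¹ • sphereVector (orbitInvariant p) = z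
  rw [hp, sphereVector_smul hs.le, h, norm_smul, hz, mul_one, Real.norm_eq_abs,
    abs_of_pos (by positivity), smul_smul, inv_mul_cancel₀ (by positivity), one_smul]

/-- The homeomorphism of the orbit space with the unit sphere of a five-dimensional space. -/
noncomputable def orbitHomeo :
    OrbitSpace ≃ₜ Metric.sphere (0 : WithLp 2 (WithLp 2 (ℂ × ℝ) × ℂ)) 1 :=
  Continuous.homeoOfEquivCompactToT2
    (f := Equiv.ofBijective orbitToSphere ⟨orbitToSphere_injective, orbitToSphere_surjective⟩)
    continuous_orbitToSphere

/-! ### The moment map in terms of sides -/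

theorem grassmannMoment_colSpan (A : Matrix.unitaryGroup (Fin 3) ℂ) (q : ℕ) (hq : q ≤ 3) :
    grassmannMoment (colSpan (A : Matrix (Fin 3) (Fin 3) ℂ) q hq) (finrank_colSpan A q hq) =
      frameMoment fun a => (A : Matrix (Fin 3) (Fin 3) ℂ).col (Fin.castLE hq a) := by
  have hu : IsUnit (A : Matrix (Fin 3) (Fin 3) ℂ) := (Unitary.toUnits A).isUnit
  have hli := (Matrix.linearIndependent_cols_of_isUnit hu).comp _ (Fin.castLE_injective hq)
  refine (grassmannMoment_eq _ _ (Module.Basis.span hli)).trans ?_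
  congr 1
  funext a
  exact congrArg Subtype.val (Module.Basis.span_apply hli a)

/-- A minor of the first two columns is, up to a phase, the conjugate of the complementary entry of
the last column. -/
theorem norm_adjugate_unitary (A : Matrix.unitaryGroup (Fin 3) ℂ) (i j : Fin 3) :
    ‖(A : Matrix (Fin 3) (Fin 3) ℂ).adjugate i j‖ = ‖A j i‖ := by
  have h : (A : Matrix (Fin 3) (Fin 3) ℂ).adjugate =
      (A : Matrix (Fin 3) (Fin 3) ℂ).det • star (A : Matrix (Fin 3) (Fin 3) ℂ) := by
    calc _ = star (A : Matrix (Fin 3) (Fin 3) ℂ) * A * (A : Matrix (Fin 3) (Fin 3) ℂ).adjugate := by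
          rw [Matrix.UnitaryGroup.star_mul_self, one_mul]
      _ = _ := by rw [mul_assoc, Matrix.mul_adjugate, mul_smul_comm, mul_one]
  have hd : ‖(A : Matrix (Fin 3) (Fin 3) ℂ).det‖ = 1 :=
    CStarRing.norm_of_mem_unitary (Matrix.det_of_mem_unitary A.2)
  rw [h, Matrix.smul_apply, smul_eq_mul, norm_mul, hd, one_mul, Matrix.star_apply, norm_star]

theorem frameMoment_one (v : Fin 1 → Fin 3 → ℂ) (hv : ∑ k, ‖v 0 k‖ ^ 2 = 1) (i : Fin 3) :
    frameMoment v i = ‖v 0 i‖ ^ 2 := by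
  let e : Fin 3 → {J : Finset (Fin 3) // J.card = 1} := fun k => ⟨{k}, Finset.card_singleton k⟩
  have he : Function.Bijective e := by decide
  have hp : ∀ k, plucker v (e k) = v 0 k := by
    intro k
    simp [plucker, e]
  rw [frameMoment, ← he.sum_comp, ← he.sum_comp]
  simp only [hp, hv, inv_one, one_smul, Finset.sum_apply, Pi.smul_apply]
  rw [Finset.sum_eq_single i]
  · simp [delta, e]
  · intro k _ hk
    simp [delta, e, hk.symm]
  · simp

/-- If `n` is a unit vector whose entries are, up to phases, the minors of a frame of a plane, then
the moment of the frame is `1 - |nᵢ|²`. -/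
theorem frameMoment_two (v : Fin 2 → Fin 3 → ℂ) (n : Fin 3 → ℂ) (hn : ∑ k, ‖n k‖ ^ 2 = 1)
    (h0 : ‖v 0 1 * v 1 2 - v 1 1 * v 0 2‖ = ‖n 0‖)
    (h1 : ‖v 0 0 * v 1 2 - v 1 0 * v 0 2‖ = ‖n 1‖)
    (h2 : ‖v 0 0 * v 1 1 - v 1 0 * v 0 1‖ = ‖n 2‖) (i : Fin 3) :
    frameMoment v i = 1 - ‖n i‖ ^ 2 := by
  let e : Fin 3 → {J : Finset (Fin 3) // J.card = 2} := fun k => ⟨{k}ᶜ, by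
    rw [Finset.card_compl, Finset.card_singleton, Fintype.card_fin]⟩
  have he : Function.Bijective e := by decide
  have hord : ∀ k : Fin 3, (![![1, 0, 0] k, ![2, 2, 1] k] : Fin 2 → Fin 3) =
      (e k).1.orderEmbOfFin (e k).2 := fun k =>
    Finset.orderEmbOfFin_unique (e k).2 (by revert k; decide)
      fun a b => by revert k a b; decide
  have hp : ∀ k, ‖plucker v (e k)‖ = ‖n k‖ := by
    intro k
    simp only [plucker, Matrix.det_fin_two, Matrix.of_apply, ← hord k]
    fin_cases k
    · exact h0
    · exact h1
    · exact h2
  rw [frameMoment, ← he.sum_comp, ← he.sum_comp]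
  simp only [hp, hn, inv_one, one_smul, Finset.sum_apply, Pi.smul_apply]
  rw [← hn, Fin.sum_univ_three, Fin.sum_univ_three]
  fin_cases i <;> simp [delta, e] <;> ring

theorem flagMoment_unitaryFlag (A : Matrix.unitaryGroup (Fin 3) ℂ) (i : Fin 3) :
    flagMoment (unitaryFlag A) i = 1 + (side A i).snd := by
  have e1 : grassmannMoment (unitaryFlag A).line (unitaryFlag A).finrank_line i = ‖A i 0‖ ^ 2 := by
    refine (congrFun (grassmannMoment_colSpan A 1 _) i).trans ?_
    exact frameMoment_one _ (unitary_col_norm A 0) i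
  have hadj := norm_adjugate_unitary A 2
  rw [Matrix.adjugate_fin_three] at hadj
  have e2 : grassmannMoment (unitaryFlag A).plane (unitaryFlag A).finrank_plane i =
      1 - ‖A i 2‖ ^ 2 := by
    refine (congrFun (grassmannMoment_colSpan A 2 _) i).trans ?_
    refine frameMoment_two _ (fun k => A k 2) (unitary_col_norm A 2) ?_ ?_ ?_ i
    · rw [← hadj 0]
      change ‖A 1 0 * A 2 1 - A 1 1 * A 2 0‖ = ‖A 1 0 * A 2 1 - A 1 1 * A 2 0‖
      rfl
    · rw [← hadj 1, ← norm_neg]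
      change ‖-(A 0 0 * A 2 1 - A 0 1 * A 2 0)‖ = ‖-(A 0 0 * A 2 1) + A 0 1 * A 2 0‖
      congr 1
      ring
    · rw [← hadj 2]
      change ‖A 0 0 * A 1 1 - A 0 1 * A 1 0‖ = ‖A 0 0 * A 1 1 - A 0 1 * A 1 0‖
      rfl
  rw [flagMoment, Pi.add_apply, e1, e2, side, hopf_snd]
  ring

/-- The point of the plane `x₁ + x₂ + x₃ = 3` whose first two coordinates exceed `1` by the real and
the imaginary part of `x`. -/
def momentPoint (x : ℂ) : Fin 3 → ℝ := ![1 + x.re, 1 + x.im, 1 - x.re - x.im]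

theorem continuous_momentPoint : Continuous momentPoint := by
  refine continuous_pi fun i => ?_
  fin_cases i <;> simp only [momentPoint] <;> simp <;> fun_prop

theorem momentPoint_injective : Function.Injective momentPoint := by
  intro x y h
  have h0 : 1 + x.re = 1 + y.re := congrFun h 0
  have h1 : 1 + x.im = 1 + y.im := congrFun h 1
  exact Complex.ext (by linarith) (by linarith)

theorem orbitMoment_eq (p : OrbitSpace) : orbitMoment p = momentPoint (orbitInvariant p).2 := by
  obtain ⟨A, rfl⟩ := isQuotientMap_orbitProj.surjective p
  rw [orbitInvariant_orbitProj]
  have hs := sum_side_snd A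
  rw [Fin.sum_univ_three] at hs
  funext i
  refine (flagMoment_unitaryFlag A i).trans ?_
  fin_cases i
  · rfl
  · rfl
  · change 1 + (side A 2).snd = 1 - (side A 0).snd - (side A 1).snd
    linarith

theorem continuous_orbitMoment : Continuous orbitMoment := by
  rw [funext orbitMoment_eq]
  exact continuous_momentPoint.comp (continuous_snd.comp orbitInvariant.continuous)

/-! ### The hexagon -/

theorem perimeter_zero (x : ℂ) : perimeter 0 0 x = |x.re| + |x.im| + |x.re + x.im| := by
  simp [perimeter]

theorem convex_hexagon : Convex ℝ hexagon := convex_convexHull ℝ _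

theorem perm_mem_hexagon (σ : Equiv.Perm (Fin 3)) : (fun i => ((σ i : ℕ) : ℝ)) ∈ hexagon :=
  subset_convexHull ℝ _ ⟨σ, rfl⟩

theorem one_mem_hexagon : (1 : Fin 3 → ℝ) ∈ hexagon := by
  have h := convex_hexagon (perm_mem_hexagon 1) (perm_mem_hexagon (Equiv.swap 0 2))
    (a := 1 / 2) (b := 1 / 2) (by norm_num) (by norm_num) (by norm_num)
  convert h using 1
  funext i
  fin_cases i <;> (simp [Equiv.swap_apply_def]; try norm_num)

theorem root_mem_hexagon (i j : Fin 3) :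
    (fun k => 1 + (if k = i then 1 else 0) - (if k = j then 1 else 0) : Fin 3 → ℝ) ∈ hexagon := by
  by_cases hij : i = j
  · subst hij
    convert one_mem_hexagon using 1
    funext k
    simp
  · have hex : ∀ i j : Fin 3, i ≠ j → ∃ σ : Equiv.Perm (Fin 3), σ i = 2 ∧ σ j = 0 ∧
        ∀ k, k ≠ i → k ≠ j → σ k = 1 := by decide
    obtain ⟨σ, hi, hj, hk⟩ := hex i j hij
    convert perm_mem_hexagon σ using 1
    funext k
    by_cases h1 : k = i
    · subst h1
      simp [hi, hij]
      norm_num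
    · by_cases h2 : k = j
      · subst h2
        simp [hj, h1]
      · simp [hk k h1 h2, h1, h2]

theorem mem_hexagon_iff {x : Fin 3 → ℝ} : x ∈ hexagon ↔ ∑ i, x i = 3 ∧ ∑ i, |x i - 1| ≤ 2 := by
  constructor
  · intro hx
    refine convexHull_min (s := Set.range fun (σ : Equiv.Perm (Fin 3)) (i : Fin 3) =>
      ((σ i : ℕ) : ℝ)) (t := {x | ∑ i, x i = 3 ∧ ∑ i, |x i - 1| ≤ 2}) ?_ ?_ hx
    · rintro _ ⟨σ, rfl⟩
      refine ⟨(Equiv.sum_comp σ fun j => ((j : ℕ) : ℝ)).trans ?_,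
        ((Equiv.sum_comp σ fun j => |((j : ℕ) : ℝ) - 1|).trans ?_).le⟩
      · norm_num [Fin.sum_univ_three]
      · norm_num [Fin.sum_univ_three]
    · rintro y ⟨hy1, hy2⟩ z ⟨hz1, hz2⟩ a b ha hb hab
      constructor
      · simp only [Pi.add_apply, Pi.smul_apply, smul_eq_mul, Finset.sum_add_distrib,
          ← Finset.mul_sum, hy1, hz1]
        rw [← add_mul, hab, one_mul]
      · calc ∑ i, |(a • y + b • z) i - 1| ≤ ∑ i, (a * |y i - 1| + b * |z i - 1|) := by
              refine Finset.sum_le_sum fun i _ => ?_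
              have : (a • y + b • z) i - 1 = a * (y i - 1) + b * (z i - 1) := by
                simp only [Pi.add_apply, Pi.smul_apply, smul_eq_mul]
                linear_combination hab
              rw [this]
              refine (abs_add_le _ _).trans_eq ?_
              rw [abs_mul, abs_mul, abs_of_nonneg ha, abs_of_nonneg hb]
          _ = a * ∑ i, |y i - 1| + b * ∑ i, |z i - 1| := by
              rw [Finset.sum_add_distrib, Finset.mul_sum, Finset.mul_sum]
          _ ≤ a * 2 + b * 2 := by gcongr
          _ = 2 := by rw [← add_mul, hab, one_mul]
  · rintro ⟨h1, h2⟩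
    set p : Fin 3 → ℝ := fun i => (x i - 1)⁺ with hp
    set n : Fin 3 → ℝ := fun i => (x i - 1)⁻ with hn
    have hp0 : ∀ i, 0 ≤ p i := fun i => posPart_nonneg _
    have hn0 : ∀ i, 0 ≤ n i := fun i => negPart_nonneg _
    have hpn : ∀ i, p i - n i = x i - 1 := fun i => posPart_sub_negPart _
    have hpn' : ∀ i, p i + n i = |x i - 1| := fun i => posPart_add_negPart _
    have hS : ∑ i, n i = ∑ i, p i := by
      have : ∑ i, (p i - n i) = 0 := by
        simp only [hpn, Finset.sum_sub_distrib, h1]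
        norm_num
      rw [Finset.sum_sub_distrib] at this
      linarith
    have hS1 : ∑ i, p i ≤ 1 := by
      simp only [← hpn', Finset.sum_add_distrib, hS] at h2
      linarith
    have hS0 : 0 ≤ ∑ i, p i := Finset.sum_nonneg fun i _ => hp0 i
    set S := ∑ i, p i with hSdef
    rcases hS0.eq_or_lt with h | h
    · have hpz : ∀ i, p i = 0 := fun i =>
        (Finset.sum_eq_zero_iff_of_nonneg fun i _ => hp0 i).1 (hSdef ▸ h.symm) i (Finset.mem_univ _)
      have hnz : ∀ i, n i = 0 := fun i =>
        (Finset.sum_eq_zero_iff_of_nonneg fun i _ => hn0 i).1 (hS.trans h.symm) i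
          (Finset.mem_univ _)
      convert one_mem_hexagon using 1
      funext i
      have := hpn i
      rw [hpz, hnz] at this
      simp only [Pi.one_apply]
      linarith
    · -- the positive excess of `x` over the centre is distributed over the pairs `(i, j)`
      have hm : ∑ ij : Fin 3 × Fin 3, (p ij.1 * n ij.2 / S ^ 2) •
          (fun k => 1 + (if k = ij.1 then 1 else 0) - (if k = ij.2 then 1 else 0) : Fin 3 → ℝ) ∈
            hexagon := by
        refine convex_hexagon.sum_mem (fun ij _ => ?_) ?_ fun ij _ => root_mem_hexagon ij.1 ij.2
        · exact div_nonneg (mul_nonneg (hp0 _) (hn0 _)) (sq_nonneg _)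
        · rw [← Finset.sum_div, Fintype.sum_prod_type]
          simp only [← Finset.mul_sum, ← Finset.sum_mul, hS, ← hSdef]
          field_simp
      have hc := convex_hexagon one_mem_hexagon hm (sub_nonneg.2 hS1) h.le (by ring)
      convert hc using 1
      funext k
      rw [Fin.sum_univ_three] at hS hSdef
      have hk := hpn k
      simp only [Pi.add_apply, Pi.smul_apply, smul_eq_mul, Pi.one_apply, mul_one,
        Fintype.sum_prod_type, Fin.sum_univ_three]
      have hx : x k = 1 + p k - n k := by linarith
      rw [hx]
      have hp' : p 0 = S - p 1 - p 2 := by linarith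
      have hn' : n 0 = S - n 1 - n 2 := by linarith
      fin_cases k <;> simp [hp', hn'] <;> field_simp <;> ring

theorem mem_hexagon_iff_exists {x : Fin 3 → ℝ} :
    x ∈ hexagon ↔ ∃ ξ, momentPoint ξ = x ∧ perimeter 0 0 ξ ≤ 2 := by
  rw [mem_hexagon_iff]
  simp only [perimeter_zero, Fin.sum_univ_three]
  constructor
  · rintro ⟨h1, h2⟩
    refine ⟨⟨x 0 - 1, x 1 - 1⟩, ?_, ?_⟩
    · funext i
      fin_cases i
      · change 1 + (x 0 - 1) = x 0
        ring
      · change 1 + (x 1 - 1) = x 1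
        ring
      · change 1 - (x 0 - 1) - (x 1 - 1) = x 2
        linarith
    · have : x 0 - 1 + (x 1 - 1) = -(x 2 - 1) := by linarith
      simpa only [this, abs_neg] using h2
  · rintro ⟨ξ, rfl, h⟩
    have e : (1 - ξ.re - ξ.im) - 1 = -(ξ.re + ξ.im) := by ring
    simp only [momentPoint, Matrix.cons_val, add_sub_cancel_left, e, abs_neg]
    exact ⟨by ring, h⟩

/-- At an interior point of the hexagon the defining inequality is strict. -/
theorem perimeter_lt_of_mem_intrinsicInterior {ξ : ℂ}
    (h : momentPoint ξ ∈ intrinsicInterior ℝ hexagon) : perimeter 0 0 ξ < 2 := by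
  obtain ⟨y, hy, hyx⟩ := mem_intrinsicInterior.1 h
  -- the ray from the centre stays in the hexagon for a while after passing the interior point
  have hc : (1 : Fin 3 → ℝ) ∈ affineSpan ℝ hexagon := subset_affineSpan ℝ _ one_mem_hexagon
  let g : ℝ → affineSpan ℝ hexagon := fun t =>
    ⟨AffineMap.lineMap (1 : Fin 3 → ℝ) (y : Fin 3 → ℝ) t, AffineMap.lineMap_mem t hc y.2⟩
  have hcont : Continuous g := AffineMap.lineMap_continuous.subtype_mk _
  have hg1 : g 1 = y := Subtype.ext (AffineMap.lineMap_apply_one _ _)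
  have hnhds : ∀ᶠ t in 𝓝 (1 : ℝ), g t ∈ ((↑) ⁻¹' hexagon : Set (affineSpan ℝ hexagon)) := by
    apply hcont.continuousAt.eventually_mem
    rw [hg1]
    exact mem_interior_iff_mem_nhds.1 hy
  obtain ⟨t, ht1, ht⟩ := ((eventually_mem_nhdsWithin (a := (1 : ℝ)) (s := Set.Ioi 1)).and
    (hnhds.filter_mono nhdsWithin_le_nhds)).exists
  have e : (g t : Fin 3 → ℝ) = momentPoint (t * ξ) := by
    change AffineMap.lineMap (1 : Fin 3 → ℝ) (y : Fin 3 → ℝ) t = _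
    rw [hyx, AffineMap.lineMap_apply]
    funext i
    simp only [vsub_eq_sub, vadd_eq_add, Pi.add_apply, Pi.smul_apply, Pi.sub_apply, Pi.one_apply,
      smul_eq_mul]
    fin_cases i <;> simp [momentPoint] <;> ring
  rw [Set.mem_preimage, e, mem_hexagon_iff_exists] at ht
  obtain ⟨η, hη, hη2⟩ := ht
  rw [momentPoint_injective hη] at hη2
  have ht0 : (0 : ℝ) < t := zero_lt_one.trans ht1
  have hs := perimeter_smul ht0.le 0 0 ξ
  rw [mul_zero] at hs
  rw [hs] at hη2
  have : (1 : ℝ) < t := ht1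
  nlinarith

/-! ### The fibres of the moment map -/

theorem perimeter_lt {w₀ w₁ : ℂ} (h : ¬(w₀ = 0 ∧ w₁ = 0)) (x : ℂ) {s t : ℝ} (hs : 0 ≤ s)
    (hst : s < t) : perimeter (s * w₀) (s * w₁) x < perimeter (t * w₀) (t * w₁) x := by
  have ht : 0 < t := hs.trans_lt hst
  have hle : ∀ (w : ℂ) (r : ℝ), √(‖(s : ℂ) * w‖ ^ 2 + r ^ 2) ≤ √(‖(t : ℂ) * w‖ ^ 2 + r ^ 2) := by
    intro w r
    simp only [norm_mul, Complex.norm_real, Real.norm_eq_abs, abs_of_nonneg hs, abs_of_pos ht]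
    gcongr
  have hlt : ∀ (w : ℂ) (r : ℝ), w ≠ 0 →
      √(‖(s : ℂ) * w‖ ^ 2 + r ^ 2) < √(‖(t : ℂ) * w‖ ^ 2 + r ^ 2) := by
    intro w r hw
    have := norm_pos_iff.2 hw
    simp only [norm_mul, Complex.norm_real, Real.norm_eq_abs, abs_of_nonneg hs, abs_of_pos ht]
    apply Real.sqrt_lt_sqrt (by positivity)
    gcongr
  simp only [perimeter, norm_toLp_pair, ← mul_add]
  by_cases h0 : w₀ = 0
  · exact add_lt_add_of_lt_of_le (add_lt_add_of_le_of_lt (hle _ _)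
      (hlt _ _ fun h1 => h ⟨h0, h1⟩)) (hle _ _)
  · exact add_lt_add_of_lt_of_le (add_lt_add_of_lt_of_le (hlt _ _ h0) (hle _ _)) (hle _ _)

theorem perimeter_zero_le (w₀ w₁ x : ℂ) : perimeter 0 0 x ≤ perimeter w₀ w₁ x := by
  simp only [perimeter, norm_toLp_pair, add_zero, norm_zero]
  gcongr <;> simp

theorem exists_perimeter_scale_eq_two {w₀ w₁ x : ℂ} (h : ¬(w₀ = 0 ∧ w₁ = 0))
    (hx : perimeter 0 0 x ≤ 2) : ∃ s : ℝ, 0 ≤ s ∧ perimeter (s * w₀) (s * w₁) x = 2 := by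
  have hpos : 0 < ‖w₀‖ + ‖w₁‖ := by
    by_contra hle
    have h0 := norm_nonneg w₀
    have h1 := norm_nonneg w₁
    exact h ⟨norm_eq_zero.1 (by linarith), norm_eq_zero.1 (by linarith)⟩
  set b := 2 / (‖w₀‖ + ‖w₁‖) with hb
  have hb0 : 0 ≤ b := by positivity
  have hcont := continuous_perimeter_scale w₀ w₁ x
  have hstart : perimeter ((0 : ℝ) * w₀) ((0 : ℝ) * w₁) x ≤ 2 := by
    rwa [Complex.ofReal_zero, zero_mul, zero_mul]
  have hend : 2 ≤ perimeter (b * w₀) (b * w₁) x := by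
    have hle : ∀ (w : ℂ) (r : ℝ), b * ‖w‖ ≤ √(‖(b : ℂ) * w‖ ^ 2 + r ^ 2) := by
      intro w r
      apply Real.le_sqrt_of_sq_le
      rw [norm_mul, Complex.norm_real, Real.norm_eq_abs, abs_of_nonneg hb0]
      nlinarith [sq_nonneg r]
    have e : b * ‖w₀‖ + b * ‖w₁‖ = 2 := by
      rw [hb]
      field_simp
    have h2 := Real.sqrt_nonneg (‖(b : ℂ) * w₀ + b * w₁‖ ^ 2 + (x.re + x.im) ^ 2)
    simp only [perimeter, norm_toLp_pair]
    linarith [hle w₀ x.re, hle w₁ x.im]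
  obtain ⟨s, hs, hs2⟩ := intermediate_value_Icc hb0 hcont.continuousOn ⟨hstart, hend⟩
  exact ⟨s, hs.1, hs2⟩

theorem range_orbitMoment : Set.range orbitMoment = hexagon := by
  ext x
  rw [mem_hexagon_iff_exists]
  constructor
  · rintro ⟨p, rfl⟩
    obtain ⟨w₀, w₁, ξ, h, hp⟩ := exists_perimeter_eq p
    exact ⟨ξ, by rw [orbitMoment_eq, hp], h ▸ perimeter_zero_le w₀ w₁ ξ⟩
  · rintro ⟨ξ, rfl, h⟩
    obtain ⟨s, -, hs⟩ := exists_perimeter_scale_eq_two (w₀ := 1) (w₁ := 0) (by simp) h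
    obtain ⟨p, hp⟩ := exists_orbitInvariant_eq hs
    exact ⟨p, by rw [orbitMoment_eq, hp]⟩

theorem exists_perimeter_eq_of_mem_fibre {ξ : ℂ} (p : {p // orbitMoment p = momentPoint ξ}) :
    ∃ w₀ w₁ : ℂ, perimeter w₀ w₁ ξ = 2 ∧ orbitInvariant p.1 = (hopf w₀ w₁, ξ) := by
  obtain ⟨w₀, w₁, η, h, hp⟩ := exists_perimeter_eq p.1
  have := p.2
  rw [orbitMoment_eq, hp] at this
  obtain rfl := momentPoint_injective this
  exact ⟨w₀, w₁, h, hp⟩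

/-- A fibre of the moment map over an interior point is the quotient by the circle of a star-shaped
sphere in `ℂ²`, so that the Hopf map identifies it with `S²`. -/
theorem nonempty_fibre_homeo {ξ : ℂ} (hξ : perimeter 0 0 ξ < 2) :
    Nonempty ({p : OrbitSpace // orbitMoment p = momentPoint ξ} ≃ₜ CP1) := by
  have hcomp : CompactSpace {p : OrbitSpace // orbitMoment p = momentPoint ξ} :=
    isCompact_iff_compactSpace.1
      ((isClosed_singleton.preimage continuous_orbitMoment).isCompact : IsCompact
        {p | orbitMoment p = momentPoint ξ})
  have hne : ∀ w₀ w₁ : ℂ, perimeter w₀ w₁ ξ = 2 → ¬(w₀ = 0 ∧ w₁ = 0) := by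
    rintro w₀ w₁ h ⟨rfl, rfl⟩
    exact hξ.ne h
  have hne' : ∀ p : {p : OrbitSpace // orbitMoment p = momentPoint ξ},
      (orbitInvariant p.1).1 ≠ 0 := by
    intro p h0
    obtain ⟨w₀, w₁, h, hp⟩ := exists_perimeter_eq_of_mem_fibre p
    rw [hp] at h0
    exact hne w₀ w₁ h (hopf_eq_zero_iff.1 h0)
  let f : {p : OrbitSpace // orbitMoment p = momentPoint ξ} →
      Metric.sphere (0 : WithLp 2 (ℂ × ℝ)) 1 := fun p =>
    ⟨‖(orbitInvariant p.1).1‖⁻¹ • (orbitInvariant p.1).1, by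
      simpa using norm_smul_inv_norm (𝕜 := ℝ) (hne' p)⟩
  have hf : Continuous f := by
    have h : Continuous fun p : {p : OrbitSpace // orbitMoment p = momentPoint ξ} =>
        (orbitInvariant p.1).1 :=
      continuous_fst.comp (orbitInvariant.continuous.comp continuous_subtype_val)
    exact ((h.norm.inv₀ fun p => norm_ne_zero_iff.2 (hne' p)).smul h).subtype_mk _
  have hinj : Function.Injective f := by
    intro p q hpq
    apply Subtype.ext
    apply orbitInvariant_injective
    have h := congrArg Subtype.val hpq
    change ‖(orbitInvariant p.1).1‖⁻¹ • (orbitInvariant p.1).1 =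
      ‖(orbitInvariant q.1).1‖⁻¹ • (orbitInvariant q.1).1 at h
    have hp0 := hne' p
    have hq0 := hne' q
    obtain ⟨w₀, w₁, hp, hp'⟩ := exists_perimeter_eq_of_mem_fibre p
    obtain ⟨v₀, v₁, hq, hq'⟩ := exists_perimeter_eq_of_mem_fibre q
    rw [hp'] at h hp0 ⊢
    rw [hq'] at h hq0 ⊢
    dsimp only at h hp0 hq0
    set s := √(‖hopf w₀ w₁‖ / ‖hopf v₀ v₁‖) with hs
    have hs0 : 0 ≤ s := Real.sqrt_nonneg _
    have hs2 : s ^ 2 = ‖hopf w₀ w₁‖ / ‖hopf v₀ v₁‖ := Real.sq_sqrt (by positivity)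
    have h1 : hopf w₀ w₁ = hopf (s * v₀) (s * v₁) := by
      rw [hopf_mul, Complex.norm_real, Real.norm_eq_abs, sq_abs, hs2, div_eq_mul_inv, mul_smul, ← h,
        smul_smul, mul_inv_cancel₀ (norm_ne_zero_iff.2 hp0), one_smul]
    -- both triangles have perimeter two, and the perimeter increases strictly with the factor `s`
    have h2 : perimeter (s * v₀) (s * v₁) ξ = perimeter v₀ v₁ ξ := by
      obtain ⟨c, hc0, hc1⟩ := hopf_eq_iff.1 h1
      rw [hq, ← hp, hc0, hc1, perimeter_circle_mul]
    have h3 : s = 1 := by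
      rcases lt_trichotomy s 1 with hlt | heq | hgt
      · have := perimeter_lt (hne v₀ v₁ hq) ξ hs0 hlt
        rw [h2, Complex.ofReal_one, one_mul, one_mul] at this
        exact absurd this (lt_irrefl _)
      · exact heq
      · have := perimeter_lt (hne v₀ v₁ hq) ξ zero_le_one hgt
        rw [h2, Complex.ofReal_one, one_mul, one_mul] at this
        exact absurd this (lt_irrefl _)
    rw [h1, h3, Complex.ofReal_one, one_mul, one_mul]
  have hsurj : Function.Surjective f := by
    rintro ⟨y, hy⟩
    rw [mem_sphere_zero_iff_norm] at hy
    obtain ⟨u, v, rfl⟩ := exists_hopf_eq y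
    have huv : ¬(u = 0 ∧ v = 0) := by
      intro h
      rw [hopf_eq_zero_iff.2 h, norm_zero] at hy
      exact zero_ne_one hy
    obtain ⟨s, hs0, hs⟩ := exists_perimeter_scale_eq_two huv hξ.le
    have hs1 : s ≠ 0 := by
      rintro rfl
      exact hne _ _ hs ⟨by simp, by simp⟩
    obtain ⟨p, hp⟩ := exists_orbitInvariant_eq hs
    refine ⟨⟨p, by rw [orbitMoment_eq, hp]⟩, Subtype.ext ?_⟩
    change ‖(orbitInvariant p).1‖⁻¹ • (orbitInvariant p).1 = hopf u v
    have hs3 : 0 < s ^ 2 := by positivity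
    rw [hp, hopf_mul, Complex.norm_real, Real.norm_eq_abs, sq_abs, norm_smul, hy, mul_one,
      Real.norm_eq_abs, abs_of_pos hs3, smul_smul, inv_mul_cancel₀ hs3.ne', one_smul]
  exact ⟨(Continuous.homeoOfEquivCompactToT2 (f := Equiv.ofBijective f ⟨hinj, hsurj⟩) hf).trans
    cp1Homeo.symm⟩

/-! ### The orbit space, the moment map and the join -/

theorem mainTheorem8 :
    FaithfulSMul Torus2 F3 ∧
    Set.range orbitMoment = hexagon ∧
    (∀ x ∈ intrinsicInterior ℝ hexagon, Nonempty ({p : OrbitSpace // orbitMoment p = x} ≃ₜ CP1)) ∧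
    Nonempty (OrbitSpace ≃ₜ TopJoin Circle CP1) ∧
    Nonempty (TopJoin Circle CP1 ≃ₜ Metric.sphere (0 : EuclideanSpace ℝ (Fin 5)) 1) := by
  obtain ⟨e⟩ := nonempty_join_homeo_sphere
  obtain ⟨e'⟩ := nonempty_sphere_homeo finrank_withLp_prod
  refine ⟨faithfulSMul_torus, range_orbitMoment, fun x hx => ?_, ⟨orbitHomeo.trans e.symm⟩,
    ⟨e.trans e'⟩⟩
  obtain ⟨ξ, rfl, -⟩ := mem_hexagon_iff_exists.1 (intrinsicInterior_subset hx)
  exact nonempty_fibre_homeo (perimeter_lt_of_mem_intrinsicInterior hx)
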